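/- **Setting.** Let $d\in\{2,3\}$ and let $\Omega\subset\mathbb R^d$ be a bounded domain with polygonal (polyhedral) boundary that equals the interior of its closure (for instance a Lipschitz domain). Let $A$ be a measurable, pointwise symmetric matrix-valued coefficient on $\Omega$ with $\alpha|\zeta|^2\le A(x)\zeta\cdot\zeta\le\beta|\zeta|^2$ for all $x\in\Omega$, $\zeta\in\mathbb R^d$, where $\alpha>0$. For open $\omega\subset\Omega$ put $a_\omega(u,v)=\int_\omega (A\nabla u)\cdot\nabla v\,dx$, and $a=a_\Omega$. Let $\tau_h$ be a conforming triangulation of $\overline\Omega$ into finitely many nondegenerate simplices, let $p\ge 1$, and let $V_h\subset H_0^1(\Omega)$ be the space of continuous functions that vanish on $\partial\Omega$ and are polynomials of degree at most $p$ on each element. Let $I_h$ be the degree-$p$ Lagrange interpolation operator with values in $V_h$. An open set is *resolved* if it is the interior of a union of elements. For resolved $\omega$ let $V_h(\omega)=\{v|_\omega: v\in V_h\}$ and $V_{h,0}(\omega)=\{v\in V_h:\operatorname{supp} v\subset\overline\omega\}$ (identified with the restrictions to $\omega$). Let $\omega_i\subset\omega_i^*\subset\Omega$ $(1\le i\le M)$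 be resolved, $\bigcup_i\omega_i=\Omega$, and let $\xi=\max_{x\in\Omega}\operatorname{card}\{i: x\in\omega_i\}$, $\xi^*=\max_{x\in\Omega}\operatorname{card}\{i: x\in\omega^*_i\}$. Let $\chi_1,\dots,\chi_M$ be continuous functions on $\Omega$ with $\operatorname{supp}\chi_i\subset\overline{\omega_i}$, $0\le\chi_i\le1$, $\sum_i\chi_i=1$ on $\Omega$, $\chi_i\in W^{1,\infty}(\omega_i)$ and $\|\nabla\chi_i\|_{L^\infty(\omega_i)}\le C_\chi/\operatorname{diam}(\omega_i)$, and define $\chi_{h,i}:V_h(\omega_i)\to V_{h,0}(\omega_i)$, $\chi_{h,i}(v)=I_h(\chi_i v)$. Let $V_{h,A}(\omega_i^*)=\{v\in V_h(\omega_i^*): a_{\omega_i^*}(v,w)=0\ \ \forall w\in V_{h,0}(\omega_i^*)\}$ and let $N_i$ be its dimension. Let $(\lambda_{i,j},\phi_{i,j})_{j=1}^{N_i}$ be a complete system of eigenpairs of $$a_{\omega_i}\big(\chi_{h,i}(\phi|_{\omega_i}),\chi_{h,i}(v|_{\omega_i})\big)=\lambda\,a_{\omega_i^*}(\phi,v)\qquad\forall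 v\in V_{h,A}(\omega_i^*),\qquad \lambda\in[0,+\infty],$$ that is, the $\phi_{i,j}$ form a basis of $V_{h,A}(\omega_i^*)$ and $\lambda_{i,1}\ge\lambda_{i,2}\ge\cdots$, where $\lambda=+\infty$ means that $a_{\omega_i^*}(\phi,v)=0$ for all $v\in V_{h,A}(\omega_i^*)$. For $0\le m_i\le N_i$ let $S_{m_i}(\omega_i)=\operatorname{span}\{\phi_{i,j}|_{\omega_i}: j\le m_i\}$ and $S_m(\Omega)=\{\sum_i\chi_{h,i}(\phi_i):\phi_i\in S_{m_i}(\omega_i)\}$, and define $$\Lambda=\Big(\xi\,\xi^*\max_{1\le i\le M}\lambda_{i,m_i+1}\Big)^{1/2}\in[0,+\infty],\qquad \lambda_{i,N_i+1}:=0 .$$ Fix bases $\psi_1,\dots,\psi_n$ of $V_h$, and bases of each $V_{h,0}(\omega_i^*)$ and of $S_m(\Omega)$. Let ${\bf A}=(a(\psi_k,\psi_l))_{k,l}$, let $\widetilde{\bf R}_i^T$ and ${\bf R}_S^T$ be the matrices of the inclusions $V_{h,0}(\omega_i^*)\to V_h$ and $S_m(\Omega)\to V_h$, and let $\widetilde{\boldsymbol\chi}_i$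 be the matrix of $V_{h,0}(\omega_i^*)\to V_{h,0}(\omega_i^*)$, $v\mapsto\chi_{h,i}(v|_{\omega_i})$. Put $\widetilde{\bf A}_i=\widetilde{\bf R}_i{\bf A}\widetilde{\bf R}_i^T$, ${\bf A}_S={\bf R}_S{\bf A}{\bf R}_S^T$ and $${\bf B}=\sum_{i=1}^M\widetilde{\bf R}_i^T\widetilde{\boldsymbol\chi}_i\widetilde{\bf A}_i^{-1}\widetilde{\bf R}_i+\big({\bf R}_S^T{\bf A}_S^{-1}{\bf R}_S\big)\Big({\bf I}-{\bf A}\sum_{i=1}^M\widetilde{\bf R}_i^T\widetilde{\boldsymbol\chi}_i\widetilde{\bf A}_i^{-1}\widetilde{\bf R}_i\Big).$$ For ${\bf v}\in\mathbb R^n$ let $\|{\bf v}\|_a=\sqrt{{\bf v}^T{\bf A}{\bf v}}$, and let $\|\cdot\|_a$ also denote the induced matrix norm. **Lemma.** One has $$\|{\bf I}-{\bf B}{\bf A}\|_a\le\Lambda .$$ If moreover $\Lambda<1$, then ${\bf B}{\bf A}$ is invertible and $$\|{\bf B}{\bf A}\|_a\,\|({\bf B}{\bf A})^{-1}\|_a\le\frac{1+\Lambda}{1-\Lambda}.$$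 -/

import Mathlib

open MeasureTheory Module
open scoped ENNReal Matrix

noncomputable section

namespace MSGFEM

/-- Points of Euclidean `d`-space. -/
abbrev Pt (d : ℕ) : Type := EuclideanSpace ℝ (Fin d)

/-- A (conforming) triangulation of the closure of `Ω` into finitely many nondegenerate closed
`d`-simplices, each given by its set of `d + 1` vertices; two simplices meet in the simplex spanned
by their common vertices. -/
structure Triangulation {d : ℕ} (Ω : Set (Pt d)) where
  elems : Finset (Finset (Pt d))
  card_eq : ∀ s ∈ elems, s.card = d + 1
  affineIndependent : ∀ s ∈ elems, AffineIndependent ℝ ((↑) : s → Pt d)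
  conforming : ∀ s ∈ elems, ∀ t ∈ elems,
    convexHull ℝ (s : Set (Pt d)) ∩ convexHull ℝ (t : Set (Pt d)) =
      convexHull ℝ ((s : Set (Pt d)) ∩ (t : Set (Pt d)))
  cover : closure Ω = ⋃ s ∈ elems, convexHull ℝ (s : Set (Pt d))

/-- An open set is resolved by the triangulation if it is the interior of a union of elements. -/
def Triangulation.Resolves {d : ℕ} {Ω : Set (Pt d)} (T : Triangulation Ω) (ω : Set (Pt d)) :
    Prop :=
  ∃ T' ⊆ T.elems, ω = interior (⋃ s ∈ T', convexHull ℝ (s : Set (Pt d)))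

/-- The data of the model problem, its discretization, and the domain decomposition. -/
structure Setting (d : ℕ) where
  /-- the domain: open, connected, nonempty, equal to the interior of its closure (bounded and with
  polygonal or polyhedral boundary, since it is triangulated by `T`) -/
  Ω : Set (Pt d)
  isOpen_Ω : IsOpen Ω
  isConnected_Ω : IsConnected Ω
  interior_closure_Ω : interior (closure Ω) = Ω
  /-- the coefficient, measurable, symmetric and uniformly elliptic -/
  coeff : Pt d → Matrix (Fin d) (Fin d) ℝ
  α : ℝ
  β : ℝ
  α_pos : 0 < α
  measurable_coeff : ∀ k l, AEMeasurable (fun x => coeff x k l) (volume.restrict Ω)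
  symm_coeff : ∀ x ∈ Ω, (coeff x).IsSymm
  elliptic_coeff : ∀ x ∈ Ω, ∀ ζ : Fin d → ℝ,
    α * (ζ ⬝ᵥ ζ) ≤ (coeff x *ᵥ ζ) ⬝ᵥ ζ ∧ (coeff x *ᵥ ζ) ⬝ᵥ ζ ≤ β * (ζ ⬝ᵥ ζ)
  /-- the mesh and the polynomial degree -/
  T : Triangulation Ω
  p : ℕ
  one_le_p : 1 ≤ p
  /-- the subdomains `ω i` and the oversampling domains `ωs i` -/
  M : ℕ
  ω : Fin M → Set (Pt d)
  ωs : Fin M → Set (Pt d)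
  resolves_ω : ∀ i, T.Resolves (ω i)
  resolves_ωs : ∀ i, T.Resolves (ωs i)
  ω_subset_ωs : ∀ i, ω i ⊆ ωs i
  iUnion_ω : ⋃ i, ω i = Ω
  /-- the partition of unity. Lipschitz regularity together with the almost everywhere bound on the
  classical gradient is membership in `W^{1,∞}(ω i)` with the corresponding bound. -/
  χ : Fin M → Pt d → ℝ
  Cχ : ℝ
  tsupport_χ : ∀ i, tsupport (χ i) ⊆ closure (ω i)
  χ_nonneg : ∀ i, ∀ x ∈ Ω, 0 ≤ χ i x
  χ_le_one : ∀ i, ∀ x ∈ Ω, χ i x ≤ 1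
  sum_χ : ∀ x ∈ Ω, ∑ i, χ i x = 1
  continuousOn_χ : ∀ i, ContinuousOn (χ i) Ω
  locallyLipschitzOn_χ : ∀ i, LocallyLipschitzOn (ω i) (χ i)
  gradient_χ : ∀ i, ∀ᵐ x ∂(volume.restrict (ω i)),
    ‖gradient (χ i) x‖ ≤ Cχ / Metric.diam (ω i)

/-- Restriction of functions to `ω`. A function on `ω` is encoded by its extension by zero. -/
def restr {d : ℕ} (ω : Set (Pt d)) : (Pt d → ℝ) →ₗ[ℝ] (Pt d → ℝ) where
  toFun f := ω.indicator f
  map_add' f g := Set.indicator_add' ω f g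
  map_smul' c f := Set.indicator_const_smul ω c f

namespace Setting

variable {d : ℕ} (P : Setting d)

/-- `V_h`: continuous functions, vanishing on the boundary of `Ω` (and extended by zero), which are
polynomials of degree at most `p` on each element. -/
def Vh : Submodule ℝ (Pt d → ℝ) where
  carrier := {v | Continuous v ∧ (∀ x ∉ P.Ω, v x = 0) ∧
    ∀ s ∈ P.T.elems, ∃ q : MvPolynomial (Fin d) ℝ, q.totalDegree ≤ P.p ∧
      ∀ x ∈ convexHull ℝ (s : Set (Pt d)), v x = MvPolynomial.eval (fun k => x k) q}
  zero_mem' := ⟨continuous_zero, fun _ _ => rfl, fun s _ => ⟨0, by simp, by simp⟩⟩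
  add_mem' := by
    rintro u v ⟨hu, hu0, hup⟩ ⟨hv, hv0, hvp⟩
    refine ⟨hu.add hv, fun x hx => by simp [hu0 x hx, hv0 x hx], fun s hs => ?_⟩
    obtain ⟨q, hq, hqe⟩ := hup s hs
    obtain ⟨r, hr, hre⟩ := hvp s hs
    exact ⟨q + r, (MvPolynomial.totalDegree_add q r).trans (max_le hq hr),
      fun x hx => by simp [hqe x hx, hre x hx]⟩
  smul_mem' := by
    rintro c v ⟨hv, hv0, hvp⟩
    refine ⟨hv.const_smul c, fun x hx => by simp [hv0 x hx], fun s hs => ?_⟩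
    obtain ⟨q, hq, hqe⟩ := hvp s hs
    exact ⟨c • q, (MvPolynomial.totalDegree_smul_le c q).trans hq,
      fun x hx => by simp [hqe x hx, MvPolynomial.smul_eval]⟩

/-- `V_h(ω)`: restrictions to `ω` of the functions in `V_h`. -/
def VhLoc (ω : Set (Pt d)) : Submodule ℝ (Pt d → ℝ) := P.Vh.map (restr ω)

/-- `V_{h,0}(ω)`: functions in `V_h` supported in the closure of `ω`
(identified with their restrictions to `ω`). -/
def Vh0 (ω : Set (Pt d)) : Submodule ℝ P.Vh where
  carrier := {v | tsupport (v : Pt d → ℝ) ⊆ closure ω}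
  zero_mem' := by
    change tsupport (0 : Pt d → ℝ) ⊆ closure ω
    simp [tsupport]
  add_mem' {u v} hu hv := (tsupport_add (u : Pt d → ℝ) (v : Pt d → ℝ)).trans (Set.union_subset hu hv)
  smul_mem' c v hv :=
    (closure_mono (Function.support_const_smul_subset c (v : Pt d → ℝ))).trans hv

/-- The local bilinear form `∫_ω (A ∇u) · ∇v`. Finite element functions are differentiable in the
interior of every element, and their classical gradient there is their weak gradient. -/
def a (ω : Set (Pt d)) (u v : Pt d → ℝ) : ℝ :=
  ∫ x in ω, (P.coeff x *ᵥ (gradient u x).ofLp) ⬝ᵥ (gradient v x).ofLp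

/-- The Lagrange nodes of degree `p`: the points of the elements all of whose barycentric
coordinates are integer multiples of `1 / p`. -/
def nodes : Set (Pt d) :=
  {x | ∃ s ∈ P.T.elems, ∃ c : Pt d → ℕ, ∑ v ∈ s, c v = P.p ∧
    x = (P.p : ℝ)⁻¹ • ∑ v ∈ s, (c v : ℝ) • v}

/-- The Lagrange interpolation operator `I_h`: the linear map into `V_h` that preserves the values
at all nodes in `Ω` (the values of functions in `V_h` at nodes on the boundary are zero). -/
def interp : (Pt d → ℝ) →ₗ[ℝ] P.Vh :=
  Classical.epsilon fun L : (Pt d → ℝ) →ₗ[ℝ] P.Vh =>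
    ∀ (u : Pt d → ℝ), ∀ x ∈ P.nodes, x ∈ P.Ω → (L u : Pt d → ℝ) x = u x

/-- The partition of unity operator `V_h(ω_i) → V_{h,0}(ω_i)`, `w ↦ I_h(χ_i w)`. -/
def chi (i : Fin P.M) : P.VhLoc (P.ω i) →ₗ[ℝ] P.Vh0 (P.ω i) :=
  Classical.epsilon fun L : P.VhLoc (P.ω i) →ₗ[ℝ] P.Vh0 (P.ω i) =>
    ∀ w, (L w : P.Vh) = P.interp fun x => P.χ i x * (w : Pt d → ℝ) x

/-- Restriction `V_h → V_h(ω)`. -/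
def toLoc (ω : Set (Pt d)) : P.Vh →ₗ[ℝ] P.VhLoc ω := (restr ω).submoduleMap P.Vh

/-- Restriction `V_h(ω_i^*) → V_h(ω_i)`. -/
def locRestr (i : Fin P.M) : P.VhLoc (P.ωs i) →ₗ[ℝ] P.VhLoc (P.ω i) :=
  (restr (P.ω i)).restrict (by
    rintro _ ⟨v, hv, rfl⟩
    refine ⟨v, hv, ?_⟩
    simp [restr, Set.indicator_indicator, Set.inter_eq_left.mpr (P.ω_subset_ωs i)])

/-- `V_{h,0}(ω_i)` is contained in `V_{h,0}(ω_i^*)`. -/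
theorem Vh0_le (i : Fin P.M) : P.Vh0 (P.ω i) ≤ P.Vh0 (P.ωs i) :=
  fun _ hv => Set.Subset.trans hv (closure_mono (P.ω_subset_ωs i))

/-- `χ̃_{h,i} : V_{h,0}(ω_i^*) → V_{h,0}(ω_i^*)`, `v ↦ χ_{h,i}(v|_{ω_i})`. -/
def chiTilde (i : Fin P.M) : P.Vh0 (P.ωs i) →ₗ[ℝ] P.Vh0 (P.ωs i) :=
  Submodule.inclusion (P.Vh0_le i) ∘ₗ P.chi i ∘ₗ P.toLoc (P.ω i) ∘ₗ (P.Vh0 (P.ωs i)).subtype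

/-- The discrete `a`-harmonic functions `V_{h,A}(ω)`. -/
def harmonic (ω : Set (Pt d)) : Set (P.VhLoc ω) :=
  {v | ∀ w ∈ P.Vh0 ω, P.a ω (v : Pt d → ℝ) (w : Pt d → ℝ) = 0}

/-- `(μ, φ)` solves the local eigenproblem on `ω_i^*`; the eigenvalue `∞` means that `φ` lies in the
kernel of the form on the right-hand side. -/
def IsEigenpair (i : Fin P.M) (μ : ℝ≥0∞) (φ : P.VhLoc (P.ωs i)) : Prop :=
  φ ∈ P.harmonic (P.ωs i) ∧ φ ≠ 0 ∧ ∀ v ∈ P.harmonic (P.ωs i),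
    (μ = ∞ → P.a (P.ωs i) (φ : Pt d → ℝ) (v : Pt d → ℝ) = 0) ∧
    (μ ≠ ∞ →
      P.a (P.ω i) (P.chi i (P.locRestr i φ) : P.Vh) (P.chi i (P.locRestr i v) : P.Vh) =
        μ.toReal * P.a (P.ωs i) (φ : Pt d → ℝ) (v : Pt d → ℝ))

/-- A complete system of eigenfunctions (a basis of `V_{h,A}(ω_i^*)`), with the eigenvalues, counted
with multiplicity, in decreasing order. -/
structure IsEigensystem (i : Fin P.M) {N : ℕ} (φ : Fin N → P.VhLoc (P.ωs i)) (lam : Fin N → ℝ≥0∞) :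
    Prop where
  linearIndependent : LinearIndependent ℝ φ
  span_eq : (Submodule.span ℝ (Set.range φ) : Set (P.VhLoc (P.ωs i))) = P.harmonic (P.ωs i)
  antitone : Antitone lam
  isEigenpair : ∀ j, P.IsEigenpair i (lam j) (φ j)

/-- The local approximation space `S_{m_i}(ω_i)`, spanned by the restrictions of the first `m_i`
eigenfunctions. -/
def localApprox (i : Fin P.M) {N : ℕ} (φ : Fin N → P.VhLoc (P.ωs i)) (m : ℕ) :
    Submodule ℝ (P.VhLoc (P.ω i)) :=
  Submodule.span ℝ {f | ∃ j : Fin N, (j : ℕ) < m ∧ f = P.locRestr i (φ j)}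

/-- The coarse space `S_m(Ω)`: all sums `∑ i, χ_{h,i}(φ_i)` with `φ_i ∈ S_{m_i}(ω_i)`. -/
def coarse {N : Fin P.M → ℕ} (φ : ∀ i, Fin (N i) → P.VhLoc (P.ωs i)) (m : Fin P.M → ℕ) :
    Submodule ℝ P.Vh :=
  ⨆ i, (P.localApprox i (φ i) (m i)).map ((P.Vh0 (P.ω i)).subtype ∘ₗ P.chi i)

/-- The maximal number of members of a family of sets that contain a common point of `Ω`. -/
def overlap (D : Fin P.M → Set (Pt d)) : ℕ :=
  sSup ((fun x => {i | x ∈ D i}.ncard) '' P.Ω)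

/-- The first eigenvalue whose eigenfunction is not used: the eigenvalue number `m + 1`, and zero if
all eigenfunctions are used. (The numbering of `Fin N` starts with zero.) -/
def nextEigenvalue {N : ℕ} (lam : Fin N → ℝ≥0∞) (m : ℕ) : ℝ≥0∞ :=
  if h : m < N then lam ⟨m, h⟩ else 0

/-- The constant `Λ = (ξ ξ^* max_i λ_{i, m_i + 1})^{1/2}`. -/
def Lambda {N : Fin P.M → ℕ} (lam : ∀ i, Fin (N i) → ℝ≥0∞) (m : Fin P.M → ℕ) : ℝ≥0∞ :=
  ((P.overlap P.ω : ℝ≥0∞) * (P.overlap P.ωs : ℝ≥0∞) *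
    ⨆ i, nextEigenvalue (lam i) (m i)) ^ (1 / 2 : ℝ)

/-- The stiffness matrix in the basis `ψ` of `V_h`. -/
def stiffness {n : ℕ} (ψ : Basis (Fin n) ℝ P.Vh) : Matrix (Fin n) (Fin n) ℝ :=
  Matrix.of fun k l => P.a P.Ω (ψ k : Pt d → ℝ) (ψ l : Pt d → ℝ)

/-- The matrix of the embedding of a subspace `W` of `V_h` into `V_h` (it is `Rᵀ`). -/
def embMatrix {n r : ℕ} (ψ : Basis (Fin n) ℝ P.Vh) {W : Submodule ℝ P.Vh}
    (b : Basis (Fin r) ℝ W) : Matrix (Fin n) (Fin r) ℝ :=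
  LinearMap.toMatrix b ψ W.subtype

/-- The one-level part `∑ i, R̃_iᵀ χ̃_i Ã_i⁻¹ R̃_i` of the preconditioner, `Ã_i = R̃_i A R̃_iᵀ`. -/
def oneLevel {n : ℕ} (ψ : Basis (Fin n) ℝ P.Vh) {k : Fin P.M → ℕ}
    (b : ∀ i, Basis (Fin (k i)) ℝ (P.Vh0 (P.ωs i))) : Matrix (Fin n) (Fin n) ℝ :=
  ∑ i, P.embMatrix ψ (b i) * LinearMap.toMatrix (b i) (b i) (P.chiTilde i) *
    ((P.embMatrix ψ (b i))ᵀ * P.stiffness ψ * P.embMatrix ψ (b i))⁻¹ * (P.embMatrix ψ (b i))ᵀ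

/-- The coarse part `R_Sᵀ A_S⁻¹ R_S` of the preconditioner, `A_S = R_S A R_Sᵀ`. -/
def coarseLevel {n r : ℕ} (ψ : Basis (Fin n) ℝ P.Vh) {S : Submodule ℝ P.Vh}
    (c : Basis (Fin r) ℝ S) : Matrix (Fin n) (Fin n) ℝ :=
  P.embMatrix ψ c * ((P.embMatrix ψ c)ᵀ * P.stiffness ψ * P.embMatrix ψ c)⁻¹ *
    (P.embMatrix ψ c)ᵀ

/-- The two-level hybrid restricted additive Schwarz preconditioner `B`. -/
def precond {n r : ℕ} (ψ : Basis (Fin n) ℝ P.Vh) {k : Fin P.M → ℕ}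
    (b : ∀ i, Basis (Fin (k i)) ℝ (P.Vh0 (P.ωs i))) {S : Submodule ℝ P.Vh}
    (c : Basis (Fin r) ℝ S) : Matrix (Fin n) (Fin n) ℝ :=
  P.oneLevel ψ b + P.coarseLevel ψ c * (1 - P.stiffness ψ * P.oneLevel ψ b)

end Setting

/-- The norm `√(vᵀ A v)` of a vector. -/
def vecNorm {n : ℕ} (A : Matrix (Fin n) (Fin n) ℝ) (v : Fin n → ℝ) : ℝ :=
  √(v ⬝ᵥ A *ᵥ v)

/-- The induced matrix norm, the supremum of `‖W v‖ / ‖v‖` over all `v ≠ 0`. -/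
def matNorm {n : ℕ} (A W : Matrix (Fin n) (Fin n) ℝ) : ℝ≥0∞ :=
  ⨆ v : {v : Fin n → ℝ // v ≠ 0},
    ENNReal.ofReal (vecNorm A (W *ᵥ v.1)) / ENNReal.ofReal (vecNorm A v.1)

end MSGFEM

end

noncomputable section

namespace MSGFEM

/-! ### Functions whose iterated differences vanish -/

/-! With the energy projections `p i` of `v` onto `V_{h,0}(ω_i^*)` and the energy projection onto
the coarse space, `1 - B * A` is the matrix of (I - coarse projection)(I - one-level operator)
(`toMatrix_errorOp`). Since the partition of unity operators sum to the identity (`sum_pouOp`), the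
second factor sends `v` to the sum of the images of the remainders `v - p i`. Each remainder is
discrete harmonic on `ω_i^*`, with local energy at most that of `v`.

Expand a remainder in eigenfunctions. Those with large eigenvalues give a function of the coarse
space; the image of the rest, `e i`, has energy at most `λ_{i,m_i+1}` times the local energy of the
remainder (`exists_truncation`, `exists_local_splitting`). The coarse projection has minimal energy
error, so the total error is at most the energy of `∑ i, e i` (`coarse_error_le`). Counting overlaps
costs a factor `ξ` for summing the `e i` (`a_sum_le`) and `ξ^*` for summing the local energies of
`v` (`sum_a_le`); this is `error_le`. The condition number bound follows from the triangle
inequality (`condition_le`).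

Two foundations need proof. The interpolation and the partition of unity operators are defined by
choice, so their existence must be established: nodal basis functions give `exists_interpolation`,
and unisolvence of the lattice nodes (`eq_zero_of_latticePoint`) gives uniqueness and the support
property. Moreover, the inverses in `B` are genuine only because the energy form is definite on
`V_h` (`eq_zero_of_a_self_eq_zero`). The local forms may be merely semidefinite; this is where the
eigenvalue `∞` enters. If `Λ` is finite, all such eigenfunctions are in the coarse space. -/

/-- All differences of order `p + 1` of the function vanish. -/
def DiffDegreeLE {E : Type*} [Add E] : ℕ → (E → ℝ) → Prop
  | 0, f => ∀ x y, f x = f y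
  | p + 1, f => ∀ h, DiffDegreeLE p fun x => f (x + h) - f x

namespace DiffDegreeLE

variable {E F : Type*} [AddCommGroup E] [AddCommGroup F] {p q : ℕ} {f g : E → ℝ}

theorem const (c : ℝ) (p : ℕ) : DiffDegreeLE p fun _ : E => c := by
  induction p generalizing c with
  | zero => intro _ _; rfl
  | succ p ih => intro h; simpa using ih 0

theorem succ (hf : DiffDegreeLE p f) : DiffDegreeLE (p + 1) f := by
  induction p generalizing f with
  | zero =>
    intro h x y
    simp [hf (x + h) x, hf (y + h) y]
  | succ p ih => exact fun h => ih (hf h)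

theorem mono (hf : DiffDegreeLE p f) (hpq : p ≤ q) : DiffDegreeLE q f := by
  induction hpq with
  | refl => exact hf
  | step _ ih => exact ih.succ

theorem add (hf : DiffDegreeLE p f) (hg : DiffDegreeLE p g) :
    DiffDegreeLE p fun x => f x + g x := by
  induction p generalizing f g with
  | zero => intro x y; simp only [hf x y, hg x y]
  | succ p ih =>
    intro h
    convert ih (hf h) (hg h) using 2
    ring

theorem const_mul (c : ℝ) (hf : DiffDegreeLE p f) : DiffDegreeLE p fun x => c * f x := by
  induction p generalizing f with
  | zero => intro x y; simp only [hf x y]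
  | succ p ih =>
    intro h
    convert ih (hf h) using 2
    ring

theorem translate (t : E) (hf : DiffDegreeLE p f) : DiffDegreeLE p fun x => f (x + t) := by
  induction p generalizing f with
  | zero => intro x y; exact hf _ _
  | succ p ih =>
    intro h
    convert ih (hf h) using 4
    abel

theorem comp_addMonoidHom (L : F →+ E) (hf : DiffDegreeLE p f) :
    DiffDegreeLE p fun x => f (L x) := by
  induction p generalizing f with
  | zero => intro x y; exact hf _ _
  | succ p ih =>
    intro h
    simpa using ih (hf (L h))

/-- Discrete Leibniz rule: the difference of `f g` is `Δf` times the translate of `g`, plus `f`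
times `Δg`. Factors of degree zero are constants and are treated separately, because their degree
cannot be lowered. -/
theorem mul (hf : DiffDegreeLE p f) (hg : DiffDegreeLE q g) :
    DiffDegreeLE (p + q) fun x => f x * g x := by
  induction hn : p + q generalizing p q f g with
  | zero =>
    obtain ⟨rfl, rfl⟩ : p = 0 ∧ q = 0 := by omega
    intro x y
    simp only [hf x y, hg x y]
  | succ n ih =>
    rcases p with - | p
    · obtain rfl : q = n + 1 := by omega
      convert hg.const_mul (f 0) using 2 with x
      rw [hf x 0]
    rcases q with - | q
    · obtain rfl : p = n := by omega
      convert hf.const_mul (g 0) using 2 with x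
      rw [hg x 0, mul_comm]
    intro h
    have h1 := ih (hf h) (hg.translate h) (by omega)
    have h2 := ih hf (hg h) (by omega)
    convert h1.add h2 using 2
    ring

theorem sum {ι : Type*} (s : Finset ι) {f : ι → E → ℝ} (hf : ∀ i ∈ s, DiffDegreeLE p (f i)) :
    DiffDegreeLE p fun x => ∑ i ∈ s, f i x := by
  classical
  induction s using Finset.induction_on with
  | empty => simpa using const 0 p
  | insert a s ha ih =>
    simp only [Finset.sum_insert ha]
    exact (hf a (by simp)).add (ih fun i hi => hf i (by simp [hi]))

theorem prod {ι : Type*} (s : Finset ι) {f : ι → E → ℝ} {k : ι → ℕ}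
    (hf : ∀ i ∈ s, DiffDegreeLE (k i) (f i)) :
    DiffDegreeLE (∑ i ∈ s, k i) fun x => ∏ i ∈ s, f i x := by
  classical
  induction s using Finset.induction_on with
  | empty => simpa using const 1 0
  | insert a s ha ih =>
    simp only [Finset.prod_insert ha, Finset.sum_insert ha]
    exact (hf a (by simp)).mul (ih fun i hi => hf i (by simp [hi]))

theorem pow (hf : DiffDegreeLE 1 f) (k : ℕ) : DiffDegreeLE k fun x => f x ^ k := by
  simpa using prod (Finset.range k) (f := fun _ => f) (k := fun _ => 1) fun _ _ => hf

end DiffDegreeLE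

/-- A coordinate has constant first differences, so it has degree one, and products add degrees.
Unlike the total degree, the difference degree passes through affine substitutions with no
computation on coefficients. -/
theorem diffDegreeLE_eval {σ : Type*} [Fintype σ] {q : MvPolynomial σ ℝ} {p : ℕ}
    (hq : q.totalDegree ≤ p) : DiffDegreeLE p fun x : σ → ℝ => MvPolynomial.eval x q := by
  simp only [MvPolynomial.eval_eq']
  refine DiffDegreeLE.sum _ fun m hm => DiffDegreeLE.const_mul _ ?_
  refine (DiffDegreeLE.prod (k := fun i => m i) Finset.univ fun i _ =>
    DiffDegreeLE.pow ?_ _).mono ?_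
  · intro h x y
    simp
  · refine le_trans ?_ ((MvPolynomial.le_totalDegree hm).trans hq)
    rw [Finsupp.sum_fintype _ _ (fun _ => rfl)]

/-- A function of difference degree at most `p` on `ι → ℝ` that vanishes at the lattice points
`c : ι → ℕ` with `∑ c ≤ p` vanishes at all lattice points. -/
theorem DiffDegreeLE.eq_zero_of_lattice {ι : Type*} [Fintype ι] {p : ℕ} {f : (ι → ℝ) → ℝ}
    (hf : DiffDegreeLE p f)
    (h0 : ∀ c : ι → ℕ, ∑ i, c i ≤ p → f (fun i => c i) = 0) (c : ι → ℕ) :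
    f (fun i => c i) = 0 := by
  classical
  induction p generalizing f c with
  | zero =>
    rw [hf _ (fun i => ((0 : ι → ℕ) i : ℝ))]
    exact h0 0 (by simp)
  | succ p ih =>
    -- The difference in direction `i` has degree at most `p` and vanishes where `∑ c ≤ p`, since
    -- then both points lie in the range of `h0`. By induction it vanishes on the whole lattice, so
    -- unit steps do not change `f`.
    have key : ∀ (i : ι) (c : ι → ℕ),
        f (fun j => ((c + Pi.single i 1 : ι → ℕ) j : ℝ)) = f (fun j => c j) := by
      intro i c
      have e : ∀ c : ι → ℕ, (fun j => (c j : ℝ)) + Pi.single i 1 =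
          fun j => ((c + Pi.single i 1 : ι → ℕ) j : ℝ) := by
        intro c
        funext j
        by_cases h : j = i
        · subst h; simp
        · simp [h]
      have := ih (hf (Pi.single i 1)) (fun c hc => by
        rw [e, h0 c (by omega), h0 _ (by
          simp only [Pi.add_apply, Finset.sum_add_distrib, Finset.sum_pi_single']
          simpa using hc), sub_zero]) c
      rw [e] at this
      linarith
    induction hn : ∑ i, c i generalizing c with
    | zero => exact h0 c (by omega)
    | succ n ihn =>
      obtain ⟨i, hi⟩ : ∃ i, c i ≠ 0 := by
        by_contra! h
        simp [h] at hn
      have hc : c = (c - Pi.single i 1) + Pi.single i 1 := by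
        funext j
        by_cases h : j = i
        · subst h; simp; omega
        · simp [h]
      rw [hc, key]
      refine ihn _ ?_
      have := hn
      rw [hc] at this
      simp only [Pi.add_apply, Finset.sum_add_distrib, Finset.sum_pi_single'] at this
      simpa using this

theorem mvPolynomial_eq_zero_of_lattice {ι : Type*} [Fintype ι] (q : MvPolynomial ι ℝ)
    (h : ∀ c : ι → ℕ, MvPolynomial.eval (fun i => (c i : ℝ)) q = 0) : q = 0 := by
  refine MvPolynomial.funext_set (fun _ => Set.range ((↑) : ℕ → ℝ))
    (fun _ => Set.infinite_range_of_injective Nat.cast_injective) fun x hx => ?_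
  choose c hc using fun i => hx i (Set.mem_univ i)
  obtain rfl : (fun i => (c i : ℝ)) = x := funext hc
  simpa using h c

/-! ### Barycentric coordinates -/

theorem exists_mvPolynomial_affineMap {d : ℕ} (f : Pt d →ᵃ[ℝ] ℝ) :
    ∃ q : MvPolynomial (Fin d) ℝ, q.totalDegree ≤ 1 ∧
      ∀ x : Pt d, f x = MvPolynomial.eval (fun k => x k) q := by
  refine ⟨MvPolynomial.C (f 0) + ∑ k, MvPolynomial.C (f.linear (EuclideanSpace.single k 1)) *
    MvPolynomial.X k, ?_, fun x => ?_⟩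
  · refine (MvPolynomial.totalDegree_add _ _).trans (max_le (by simp) ?_)
    refine MvPolynomial.totalDegree_finsetSum_le fun k _ => ?_
    refine (MvPolynomial.totalDegree_mul _ _).trans ?_
    simp
  · have hx : x = ∑ k, x k • EuclideanSpace.single k (1 : ℝ) := by
      simpa using ((EuclideanSpace.basisFun (Fin d) ℝ).sum_repr x).symm
    rw [show f x = f.linear x + f 0 from congrFun f.decomp x]
    conv_lhs => rw [hx, map_sum]
    simp [mul_comm, add_comm]

namespace Triangulation

variable {d : ℕ} {Ω : Set (Pt d)} (T : Triangulation Ω)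

/-- The vertices of an element as an affine basis. -/
def affineBasis {s : Finset (Pt d)} (hs : s ∈ T.elems) : AffineBasis s ℝ (Pt d) :=
  ⟨(↑), T.affineIndependent s hs, by
    rw [(T.affineIndependent s hs).affineSpan_eq_top_iff_card_eq_finrank_add_one]
    simp [T.card_eq s hs]⟩

theorem range_affineBasis {s : Finset (Pt d)} (hs : s ∈ T.elems) :
    Set.range (T.affineBasis hs) = (s : Set (Pt d)) := Subtype.range_coe

open Classical in
/-- The barycentric coordinate of `x` with respect to the vertex `v` of the element `s`, and zero if
`v` is not a vertex of `s`. -/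
def bary (s : Finset (Pt d)) (v x : Pt d) : ℝ :=
  if h : s ∈ T.elems ∧ v ∈ s then (T.affineBasis h.1).coord ⟨v, h.2⟩ x else 0

variable {T} {s t : Finset (Pt d)} {v x y : Pt d}

theorem bary_of_mem (hs : s ∈ T.elems) (hv : v ∈ s) :
    T.bary s v x = (T.affineBasis hs).coord ⟨v, hv⟩ x := dif_pos ⟨hs, hv⟩

theorem bary_of_notMem (hv : v ∉ s) : T.bary s v x = 0 := dif_neg fun h => hv h.2

variable (T) in
theorem exists_affineMap_bary (s : Finset (Pt d)) (v : Pt d) :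
    ∃ f : Pt d →ᵃ[ℝ] ℝ, ∀ x, T.bary s v x = f x := by
  by_cases h : s ∈ T.elems ∧ v ∈ s
  · exact ⟨_, fun x => bary_of_mem h.1 h.2⟩
  · exact ⟨0, fun x => dif_neg h⟩

theorem continuous_bary : Continuous (T.bary s v) := by
  obtain ⟨f, hf⟩ := T.exists_affineMap_bary s v
  rw [show T.bary s v = f from funext hf]
  exact f.continuous_of_finiteDimensional

theorem bary_lineMap (ε : ℝ) :
    T.bary s v (AffineMap.lineMap x y ε) = (1 - ε) * T.bary s v x + ε * T.bary s v y := by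
  obtain ⟨f, hf⟩ := T.exists_affineMap_bary s v
  rw [hf, hf, hf, AffineMap.apply_lineMap, AffineMap.lineMap_apply_module]
  simp

theorem sum_bary (hs : s ∈ T.elems) (x : Pt d) : ∑ v ∈ s, T.bary s v x = 1 := by
  rw [← (T.affineBasis hs).sum_coord_apply_eq_one x, ← Finset.sum_coe_sort]
  exact Finset.sum_congr rfl fun v _ => bary_of_mem hs v.2

theorem sum_bary_smul (hs : s ∈ T.elems) (x : Pt d) : ∑ v ∈ s, T.bary s v x • v = x := by
  conv_rhs => rw [← (T.affineBasis hs).linear_combination_coord_eq_self x]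
  rw [← Finset.sum_coe_sort]
  exact Finset.sum_congr rfl fun v _ => by rw [bary_of_mem hs v.2]; rfl

theorem bary_eq_of_combination (hs : s ∈ T.elems) {w : Pt d → ℝ} (hw : ∑ v ∈ s, w v = 1)
    (hx : ∑ v ∈ s, w v • v = x) (hv : v ∈ s) : T.bary s v x = w v := by
  rw [bary_of_mem hs hv]
  have h1 : ∑ u : s, w u = 1 := by rw [Finset.sum_coe_sort s w, hw]
  have h2 := (T.affineBasis hs).coord_apply_combination_of_mem (Finset.mem_univ ⟨v, hv⟩) h1
  rw [Finset.affineCombination_eq_linear_combination _ _ _ h1] at h2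
  rw [← hx, ← Finset.sum_coe_sort]
  exact h2

theorem mem_convexHull_iff (hs : s ∈ T.elems) :
    x ∈ convexHull ℝ (s : Set (Pt d)) ↔ ∀ v, 0 ≤ T.bary s v x := by
  rw [← T.range_affineBasis hs, AffineBasis.convexHull_eq_nonneg_coord]
  refine ⟨fun h v => ?_, fun h v => ?_⟩
  · by_cases hv : v ∈ s
    · rw [bary_of_mem hs hv]; exact h _
    · rw [bary_of_notMem hv]
  · rw [← bary_of_mem hs v.2]; exact h _

theorem mem_interior_iff (hs : s ∈ T.elems) :
    x ∈ interior (convexHull ℝ (s : Set (Pt d))) ↔ ∀ v ∈ s, 0 < T.bary s v x := by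
  rw [← T.range_affineBasis hs, AffineBasis.interior_convexHull]
  refine ⟨fun h v hv => ?_, fun h v => ?_⟩
  · rw [bary_of_mem hs hv]; exact h _
  · rw [← bary_of_mem hs v.2]; exact h _ v.2

/-- If the coordinates in `s` are carried by common vertices, they also represent `x` in `t`, and
barycentric coordinates are unique. -/
theorem bary_eq_of_supported (hs : s ∈ T.elems) (ht : t ∈ T.elems)
    (h : ∀ v, T.bary s v x ≠ 0 → v ∈ t) (v : Pt d) : T.bary t v x = T.bary s v x := by
  classical
  by_cases hv : v ∈ t
  · refine bary_eq_of_combination ht (w := fun v => T.bary s v x) ?_ ?_ hv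
    · rw [← sum_bary hs x, ← Finset.sum_subset (Finset.inter_subset_left (s₁ := t) (s₂ := s)),
        ← Finset.sum_subset (Finset.inter_subset_right (s₁ := t) (s₂ := s))]
      · intro u _ hu
        by_contra h0
        simp_all
      · intro u _ hu
        by_contra h0
        exact h0 (bary_of_notMem (by simp_all))
    · conv_rhs => rw [← sum_bary_smul hs x]
      rw [← Finset.sum_subset (Finset.inter_subset_left (s₁ := t) (s₂ := s)),
        ← Finset.sum_subset (Finset.inter_subset_right (s₁ := t) (s₂ := s))]
      · intro u _ hu
        by_contra h0
        simp_all
      · intro u _ hu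
        rw [bary_of_notMem (by simp_all), zero_smul]
  · rw [bary_of_notMem hv]
    by_contra h0
    exact hv (h v (Ne.symm h0))

/-- This is where conformity enters: a common point is a convex combination of common vertices, so
its coordinates in `s` vanish at the vertices outside `t`. -/
theorem bary_eq_of_mem_inter (hs : s ∈ T.elems) (ht : t ∈ T.elems)
    (hxs : x ∈ convexHull ℝ (s : Set (Pt d))) (hxt : x ∈ convexHull ℝ (t : Set (Pt d)))
    (v : Pt d) : T.bary t v x = T.bary s v x := by
  classical
  refine bary_eq_of_supported hs ht (fun v hv => ?_) v
  have hx : x ∈ convexHull ℝ ((s : Set (Pt d)) ∩ t) := by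
    rw [← T.conforming s hs t ht]; exact ⟨hxs, hxt⟩
  rw [← Finset.coe_inter, Finset.mem_convexHull'] at hx
  obtain ⟨w, -, hw1, hwx⟩ := hx
  by_contra hvt
  have hvs : v ∈ s := by
    by_contra h
    exact hv (bary_of_notMem h)
  refine hv ?_
  rw [bary_eq_of_combination hs (w := fun u => if u ∈ t then w u else 0) ?_ ?_ hvs, if_neg hvt]
  · rw [← hw1, Finset.sum_ite_mem]
  · rw [← hwx]
    simp only [ite_smul, zero_smul]
    rw [Finset.sum_ite_mem]

theorem exists_mem_elems (hx : x ∈ closure Ω) :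
    ∃ s ∈ T.elems, x ∈ convexHull ℝ (s : Set (Pt d)) := by
  rw [T.cover] at hx
  simpa using hx

theorem convexHull_subset_closure (hs : s ∈ T.elems) :
    convexHull ℝ (s : Set (Pt d)) ⊆ closure Ω := by
  rw [T.cover]
  exact Set.subset_biUnion_of_mem (u := fun s : Finset (Pt d) => convexHull ℝ (s : Set (Pt d))) hs

theorem isClosed_convexHull (s : Finset (Pt d)) : IsClosed (convexHull ℝ (s : Set (Pt d))) :=
  (s.finite_toSet.isCompact_convexHull ℝ).isClosed

theorem nonempty_interior_convexHull (hs : s ∈ T.elems) :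
    (interior (convexHull ℝ (s : Set (Pt d)))).Nonempty := by
  rw [← T.range_affineBasis hs]
  exact ⟨_, AffineBasis.centroid_mem_interior_convexHull (T.affineBasis hs)⟩

theorem closure_interior_convexHull (hs : s ∈ T.elems) :
    closure (interior (convexHull ℝ (s : Set (Pt d)))) = convexHull ℝ (s : Set (Pt d)) := by
  have hc : Convex ℝ (convexHull ℝ (s : Set (Pt d))) := convex_convexHull ℝ _
  rw [hc.closure_interior_eq_closure_of_nonempty_interior (𝕜 := ℝ) (nonempty_interior_convexHull hs),
    (isClosed_convexHull s).closure_eq]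

/-- At an interior point every vertex of `s` has a positive coordinate. Agreement of coordinates
then makes it a vertex of `t`, and both have `d + 1` vertices. -/
theorem eq_of_mem_interior (hs : s ∈ T.elems) (ht : t ∈ T.elems)
    (hxs : x ∈ interior (convexHull ℝ (s : Set (Pt d))))
    (hxt : x ∈ convexHull ℝ (t : Set (Pt d))) : s = t := by
  refine Finset.eq_of_subset_of_card_le (fun v hv => ?_) (by rw [T.card_eq s hs, T.card_eq t ht])
  by_contra h
  have h1 := (mem_interior_iff hs).1 hxs v hv
  rw [← bary_eq_of_mem_inter hs ht (interior_subset hxs) hxt, bary_of_notMem h] at h1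
  exact h1.false

/-- If `y` is an interior point of the triangulated set, and `x` has positive coordinates
wherever `y` has, then `x` is an interior point as well. -/
theorem mem_interior_of_carrier (ht : t ∈ T.elems) (hx : x ∈ convexHull ℝ (t : Set (Pt d)))
    (hy : y ∈ convexHull ℝ (t : Set (Pt d))) (hyΩ : y ∈ interior (closure Ω))
    (hxy : ∀ v, T.bary t v x ≠ 0 ↔ T.bary t v y ≠ 0) : x ∈ interior (closure Ω) := by
  -- With this `δ` all coordinates of `x - δ y` are nonnegative. A point `z` near `x` is magnified
  -- to `y + δ⁻¹ • (z - x)` near `y`; if that lies in an element `u` having `y` as a point, the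
  -- coordinates of `z` in `u` are nonnegative too.
  obtain ⟨δ, hδ, hδ0⟩ : ∃ δ : ℝ, (∀ v ∈ t, δ * T.bary t v y ≤ T.bary t v x) ∧ 0 < δ := by
    refine Filter.Eventually.exists (f := nhdsWithin (0 : ℝ) (Set.Ioi 0)) (.and ?_ ?_)
    · rw [Filter.eventually_all_finset]
      intro v hv
      rcases ((mem_convexHull_iff ht).1 hx v).eq_or_lt with h | h
      · refine .of_forall fun δ => ?_
        have : T.bary t v y = 0 := by
          by_contra h1
          exact (hxy v).2 h1 h.symm
        rw [this, ← h, mul_zero]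
      · have : Filter.Tendsto (fun δ : ℝ => δ * T.bary t v y) (nhdsWithin 0 (Set.Ioi 0))
            (nhds (0 * T.bary t v y)) :=
          (continuous_id.mul continuous_const).continuousAt.tendsto.mono_left nhdsWithin_le_nhds
        rw [zero_mul] at this
        exact (this.eventually_lt_const h).mono fun _ h => h.le
    · exact self_mem_nhdsWithin
  -- Off the closed set `K`, which omits `y`, only elements containing `y` occur.
  set K : Set (Pt d) := ⋃ u ∈ {u : Finset (Pt d) | u ∈ T.elems ∧ y ∉ convexHull ℝ (u : Set (Pt d))},
    convexHull ℝ (u : Set (Pt d)) with hK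
  have hKc : IsClosed K :=
    Set.Finite.isClosed_biUnion (T.elems.finite_toSet.subset fun u hu => hu.1)
      fun u _ => isClosed_convexHull u
  have hyK : y ∉ K := by
    simp only [hK, Set.mem_iUnion, not_exists]
    exact fun u hu hyu => hu.2 hyu
  have hU : ∀ᶠ z in nhds y, z ∈ closure Ω ∧ z ∉ K :=
    Filter.Eventually.and (mem_interior_iff_mem_nhds.1 hyΩ) (hKc.isOpen_compl.mem_nhds hyK)
  have hcont : Filter.Tendsto (fun z => y + δ⁻¹ • (z - x)) (nhds x) (nhds y) := by
    have : Continuous fun z => y + δ⁻¹ • (z - x) := by fun_prop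
    simpa using this.tendsto x
  rw [mem_interior_iff_mem_nhds]
  filter_upwards [hcont.eventually hU] with z hz
  obtain ⟨u, hu, hzu⟩ := T.exists_mem_elems hz.1
  have hyu : y ∈ convexHull ℝ (u : Set (Pt d)) := by
    by_contra h
    refine hz.2 ?_
    simp only [hK, Set.mem_iUnion]
    exact ⟨u, ⟨hu, h⟩, hzu⟩
  have hby := bary_eq_of_mem_inter ht hu hy hyu
  have hsupp : ∀ v, T.bary t v x ≠ 0 → v ∈ u := by
    intro v hv
    by_contra h
    have := (hxy v).1 hv
    rw [← hby, bary_of_notMem h] at this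
    exact this rfl
  have hbx := bary_eq_of_supported ht hu hsupp
  refine convexHull_subset_closure hu ((mem_convexHull_iff hu).2 fun v => ?_)
  have h1 := (mem_convexHull_iff hu).1 hzu v
  obtain ⟨f, hf⟩ := T.exists_affineMap_bary u v
  have h2 : T.bary u v (y + δ⁻¹ • (z - x)) =
      T.bary u v y + δ⁻¹ * (T.bary u v z - T.bary u v x) := by
    simp only [hf]
    rw [add_comm y, ← vadd_eq_add, f.map_vadd, map_smul, ← vsub_eq_sub z x, f.linearMap_vsub]
    simp [add_comm]
  rw [h2, hby, hbx] at h1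
  have h3 : δ * T.bary t v y ≤ T.bary t v x := by
    by_cases hv : v ∈ t
    · exact hδ v hv
    · simp [bary_of_notMem hv]
  have h4 := mul_nonneg hδ0.le h1
  rw [mul_add, mul_inv_cancel_left₀ hδ0.ne'] at h4
  linarith

end Triangulation

/-! ### Lagrange interpolation -/

namespace Triangulation

variable {d : ℕ} {Ω : Set (Pt d)} (T : Triangulation Ω)

open Classical in
/-- The piecewise affine function that is one at the vertex `v` and zero at the other vertices. -/
def hat (v x : Pt d) : ℝ :=
  if h : ∃ s ∈ T.elems, x ∈ convexHull ℝ (s : Set (Pt d)) then T.bary h.choose v x else 0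

variable {T} {s : Finset (Pt d)} {v x : Pt d}

theorem hat_eq_bary (hs : s ∈ T.elems) (hx : x ∈ convexHull ℝ (s : Set (Pt d))) :
    T.hat v x = T.bary s v x := by
  have h : ∃ s ∈ T.elems, x ∈ convexHull ℝ (s : Set (Pt d)) := ⟨s, hs, hx⟩
  rw [hat, dif_pos h]
  exact bary_eq_of_mem_inter hs h.choose_spec.1 hx h.choose_spec.2 v

theorem continuousOn_closure {f : Pt d → ℝ}
    (hf : ∀ s ∈ T.elems, ContinuousOn f (convexHull ℝ (s : Set (Pt d)))) :
    ContinuousOn f (closure Ω) := by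
  have h := LocallyFinite.continuousOn_iUnion (f := fun s : T.elems =>
    convexHull ℝ (s.1 : Set (Pt d))) (g := f) (locallyFinite_of_finite _)
    (fun s => isClosed_convexHull s.1) (fun s => hf s.1 s.2)
  rw [T.cover]
  exact h.mono fun x hx => by simpa using hx

theorem continuousOn_hat : ContinuousOn (T.hat v) (closure Ω) :=
  continuousOn_closure fun s hs =>
    (continuous_bary (T := T) (s := s) (v := v)).continuousOn.congr fun _ hx => hat_eq_bary hs hx

end Triangulation

namespace Setting

variable {d : ℕ} (P : Setting d)

theorem cast_p_ne_zero : (P.p : ℝ) ≠ 0 := by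
  have := P.one_le_p
  positivity

/-- The point of the element `s` with barycentric coordinates `c v / p`. -/
def latticePoint (s : Finset (Pt d)) (c : Pt d → ℕ) : Pt d :=
  (P.p : ℝ)⁻¹ • ∑ v ∈ s, (c v : ℝ) • v

variable {P} {s : Finset (Pt d)} {c c' : Pt d → ℕ} {v x : Pt d}

theorem latticePoint_mem_nodes (hs : s ∈ P.T.elems) (hc : ∑ v ∈ s, c v = P.p) :
    P.latticePoint s c ∈ P.nodes := ⟨s, hs, c, hc, rfl⟩

theorem bary_latticePoint (hs : s ∈ P.T.elems) (hc : ∑ v ∈ s, c v = P.p) (hv : v ∈ s) :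
    P.T.bary s v (P.latticePoint s c) = (P.p : ℝ)⁻¹ * c v := by
  refine Triangulation.bary_eq_of_combination hs (w := fun v => (P.p : ℝ)⁻¹ * c v) ?_ ?_ hv
  · rw [← Finset.mul_sum, ← Nat.cast_sum, hc, inv_mul_cancel₀ P.cast_p_ne_zero]
  · simp only [latticePoint, Finset.smul_sum, mul_smul]

theorem latticePoint_mem (hs : s ∈ P.T.elems) (hc : ∑ v ∈ s, c v = P.p) :
    P.latticePoint s c ∈ convexHull ℝ (s : Set (Pt d)) := by
  rw [Triangulation.mem_convexHull_iff hs]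
  intro v
  by_cases hv : v ∈ s
  · rw [bary_latticePoint hs hc hv]; positivity
  · rw [Triangulation.bary_of_notMem hv]

/-- Otherwise the face carrying `x` would contain the node `z` of `Ω`. A point of the segment close
to `z` lies in the open set `Ω` and has the same carrier as `x`, so `x` is interior to the closure
of `Ω`, which is `Ω`. This makes the extension of `nodalFun` by zero continuous. -/
theorem hat_eq_zero_on_boundary (hs : s ∈ P.T.elems) (hc : ∑ v ∈ s, c v = P.p)
    (hz : P.latticePoint s c ∈ P.Ω) (hx : x ∈ closure P.Ω) (hxΩ : x ∉ P.Ω) :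
    ∃ v ∈ s, c v ≠ 0 ∧ P.T.hat v x = 0 := by
  by_contra! hne
  obtain ⟨t, ht, hxt⟩ := P.T.exists_mem_elems hx
  simp only [Triangulation.hat_eq_bary ht hxt] at hne
  set z := P.latticePoint s c with hzdef
  have hzs : ∀ v, P.T.bary s v z ≠ 0 → P.T.bary t v x ≠ 0 := by
    intro v hv
    have hvs : v ∈ s := by
      by_contra h
      exact hv (Triangulation.bary_of_notMem h)
    refine hne v hvs fun h => hv ?_
    rw [bary_latticePoint hs hc hvs, h, Nat.cast_zero, mul_zero]
  have hbz := Triangulation.bary_eq_of_supported hs ht (x := z) fun v hv => by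
    by_contra h
    exact hzs v hv (Triangulation.bary_of_notMem h)
  have hzt : z ∈ convexHull ℝ (t : Set (Pt d)) := by
    rw [Triangulation.mem_convexHull_iff ht]
    intro v
    rw [hbz]
    exact (Triangulation.mem_convexHull_iff hs).1 (latticePoint_mem hs hc) v
  obtain ⟨ε, hε, hε0, hε1⟩ : ∃ ε : ℝ, AffineMap.lineMap z x ε ∈ P.Ω ∧ 0 < ε ∧ ε < 1 := by
    have hcont : Filter.Tendsto (fun ε : ℝ => AffineMap.lineMap z x ε) (nhds 0) (nhds z) := by
      have : Continuous fun ε : ℝ => AffineMap.lineMap z x ε := AffineMap.lineMap_continuous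
      simpa using this.tendsto 0
    have h1 := (hcont.eventually (P.isOpen_Ω.mem_nhds hz)).filter_mono
      (nhdsWithin_le_nhds (s := Set.Ioi 0))
    have h2 : ∀ᶠ ε : ℝ in nhdsWithin 0 (Set.Ioi 0), ε < 1 :=
      (eventually_lt_nhds one_pos).filter_mono nhdsWithin_le_nhds
    obtain ⟨ε, h⟩ := (h1.and (h2.and self_mem_nhdsWithin)).exists
    exact ⟨ε, h.1, h.2.2, h.2.1⟩
  refine hxΩ ?_
  rw [← P.interior_closure_Ω]
  have hxn := (Triangulation.mem_convexHull_iff ht).1 hxt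
  have hzn := (Triangulation.mem_convexHull_iff ht).1 hzt
  refine Triangulation.mem_interior_of_carrier ht hxt (y := AffineMap.lineMap z x ε)
    ((convex_convexHull ℝ _).lineMap_mem hzt hxt ⟨hε0.le, hε1.le⟩)
    (by rwa [P.interior_closure_Ω]) fun v => ?_
  rw [Triangulation.bary_lineMap]
  constructor
  · intro h
    have h1 := mul_pos hε0 ((hxn v).lt_of_ne' h)
    have h2 := mul_nonneg (sub_nonneg.2 hε1.le) (hzn v)
    linarith
  · intro h h0
    rw [h0, mul_zero, add_zero, hbz] at h
    exact hzs v (right_ne_zero_of_mul h) h0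

open Classical in
variable (P s c) in
/-- A multiple of the nodal basis function of the node `P.latticePoint s c`. -/
def nodalFun (x : Pt d) : ℝ :=
  if x ∈ P.Ω then ∏ v ∈ s, ∏ k ∈ Finset.range (c v), (P.p * P.T.hat v x - k) else 0

theorem nodalFun_eq (hs : s ∈ P.T.elems) (hc : ∑ v ∈ s, c v = P.p)
    (hz : P.latticePoint s c ∈ P.Ω) (hx : x ∈ closure P.Ω) :
    P.nodalFun s c x = ∏ v ∈ s, ∏ k ∈ Finset.range (c v), (P.p * P.T.hat v x - k) := by
  by_cases hxΩ : x ∈ P.Ω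
  · exact if_pos hxΩ
  · rw [nodalFun, if_neg hxΩ]
    obtain ⟨v, hv, hcv, hv0⟩ := hat_eq_zero_on_boundary hs hc hz hx hxΩ
    refine (Finset.prod_eq_zero hv (Finset.prod_eq_zero
      (Finset.mem_range.2 (Nat.pos_of_ne_zero hcv)) ?_)).symm
    simp [hv0]

theorem nodalFun_mem_Vh (hs : s ∈ P.T.elems) (hc : ∑ v ∈ s, c v = P.p)
    (hz : P.latticePoint s c ∈ P.Ω) : P.nodalFun s c ∈ P.Vh := by
  refine ⟨?_, fun x hx => if_neg hx, fun t ht => ?_⟩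
  · rw [← continuousOn_univ,
      show (Set.univ : Set (Pt d)) = closure P.Ω ∪ P.Ωᶜ from
        (Set.eq_univ_of_forall fun x => (em (x ∈ P.Ω)).imp (fun h => subset_closure h) id).symm]
    refine ContinuousOn.union_of_isClosed ?_ ?_ isClosed_closure P.isOpen_Ω.isClosed_compl
    · refine ContinuousOn.congr ?_ fun x hx => nodalFun_eq hs hc hz hx
      refine continuousOn_finsetProd _ fun v _ => continuousOn_finsetProd _ fun k _ => ?_
      exact (continuousOn_const.mul Triangulation.continuousOn_hat).sub continuousOn_const
    · exact continuousOn_const.congr fun x hx => if_neg hx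
  · have hq : ∀ v, ∃ q : MvPolynomial (Fin d) ℝ, q.totalDegree ≤ 1 ∧
        ∀ x : Pt d, P.T.bary t v x = MvPolynomial.eval (fun k => x k) q := by
      intro v
      obtain ⟨f, hf⟩ := P.T.exists_affineMap_bary t v
      simpa only [hf] using exists_mvPolynomial_affineMap f
    choose q hq1 hq using hq
    refine ⟨∏ v ∈ s, ∏ k ∈ Finset.range (c v),
      (MvPolynomial.C (P.p : ℝ) * q v - MvPolynomial.C (k : ℝ)), ?_, fun x hx => ?_⟩
    · rw [← hc]
      refine (MvPolynomial.totalDegree_finsetProd _ _).trans (Finset.sum_le_sum fun v _ => ?_)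
      refine (MvPolynomial.totalDegree_finsetProd _ _).trans ?_
      refine (Finset.sum_le_card_nsmul _ _ 1 fun k _ => ?_).trans (by simp)
      refine (MvPolynomial.totalDegree_sub _ _).trans
        (max_le ?_ ((MvPolynomial.totalDegree_C _).trans_le zero_le_one))
      refine (MvPolynomial.totalDegree_mul _ _).trans ?_
      rw [MvPolynomial.totalDegree_C, zero_add]
      exact hq1 v
    · rw [nodalFun_eq hs hc hz (Triangulation.convexHull_subset_closure ht hx)]
      simp only [map_prod, map_sub, map_mul, MvPolynomial.eval_C, ← hq,
        Triangulation.hat_eq_bary ht hx]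

theorem nodalFun_self_ne_zero (hs : s ∈ P.T.elems) (hc : ∑ v ∈ s, c v = P.p)
    (hz : P.latticePoint s c ∈ P.Ω) : P.nodalFun s c (P.latticePoint s c) ≠ 0 := by
  rw [nodalFun_eq hs hc hz (subset_closure hz)]
  refine Finset.prod_ne_zero_iff.2 fun v hv => Finset.prod_ne_zero_iff.2 fun k hk => ?_
  rw [Triangulation.hat_eq_bary hs (latticePoint_mem hs hc), bary_latticePoint hs hc hv,
    mul_inv_cancel_left₀ P.cast_p_ne_zero, sub_ne_zero]
  exact Nat.cast_injective.ne (Finset.mem_range.1 hk).ne'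

/-- At a node, `p` times each barycentric coordinate is a natural number. If no factor vanishes,
this number is at least `c v` for every `v ∈ s`; both families have sum `p`, so they agree, and `y`
is the node itself. -/
theorem nodalFun_eq_zero (hs : s ∈ P.T.elems) (hc : ∑ v ∈ s, c v = P.p)
    (hz : P.latticePoint s c ∈ P.Ω) {y : Pt d} (hy : y ∈ P.nodes) (hyΩ : y ∈ P.Ω)
    (hne : y ≠ P.latticePoint s c) : P.nodalFun s c y = 0 := by
  obtain ⟨t, ht, e, he, hye⟩ := hy
  change y = P.latticePoint t e at hye
  rw [nodalFun_eq hs hc hz (subset_closure hyΩ)]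
  by_contra h0
  have hyt : y ∈ convexHull ℝ (t : Set (Pt d)) := by
    rw [hye]; exact latticePoint_mem ht he
  have hle : ∀ v ∈ s, (c v : ℝ) ≤ P.p * P.T.bary t v y := by
    intro v hv
    have h1 := Finset.prod_ne_zero_iff.1 (Finset.prod_ne_zero_iff.1 h0 v hv)
    rw [Triangulation.hat_eq_bary ht hyt] at h1
    obtain ⟨m, hm⟩ : ∃ m : ℕ, P.p * P.T.bary t v y = m := by
      by_cases hvt : v ∈ t
      · exact ⟨e v, by
          rw [hye, bary_latticePoint ht he hvt, mul_inv_cancel_left₀ P.cast_p_ne_zero]⟩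
      · exact ⟨0, by simp [Triangulation.bary_of_notMem hvt]⟩
    rw [hm] at h1 ⊢
    rw [Nat.cast_le]
    by_contra! hlt
    exact h1 m (Finset.mem_range.2 hlt) (sub_self _)
  have hnn := (Triangulation.mem_convexHull_iff ht).1 hyt
  have hsum : ∑ v ∈ s, P.p * P.T.bary t v y ≤ P.p := by
    classical
    rw [← Finset.mul_sum]
    refine mul_le_of_le_one_right (Nat.cast_nonneg _) ?_
    rw [← Triangulation.sum_bary ht y,
      ← Finset.sum_subset (Finset.inter_subset_left (s₁ := s) (s₂ := t))]
    · exact Finset.sum_le_sum_of_subset_of_nonneg Finset.inter_subset_right fun v _ _ => hnn v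
    · intro u hu hut
      exact Triangulation.bary_of_notMem fun h => hut (Finset.mem_inter.2 ⟨hu, h⟩)
  have heq : ∀ v ∈ s, (c v : ℝ) = P.p * P.T.bary t v y := by
    refine (Finset.sum_eq_sum_iff_of_le hle).1 (le_antisymm (Finset.sum_le_sum hle) ?_)
    rw [← Nat.cast_sum, hc]
    exact hsum
  have hbary : ∀ v ∈ s, P.T.bary t v y = (P.p : ℝ)⁻¹ * c v := by
    intro v hv
    rw [heq v hv, inv_mul_cancel_left₀ P.cast_p_ne_zero]
  refine hne ?_
  classical
  have hs1 : ∑ v ∈ s, P.T.bary t v y = 1 := by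
    rw [Finset.sum_congr rfl hbary, ← Finset.mul_sum, ← Nat.cast_sum, hc,
      inv_mul_cancel₀ P.cast_p_ne_zero]
  have hout : ∀ v ∈ t, v ∉ s → P.T.bary t v y = 0 := by
    have h1 : ∑ v ∈ t \ s, P.T.bary t v y = 0 := by
      have h2 := Finset.sum_inter_add_sum_sdiff t s fun v => P.T.bary t v y
      have h3 : ∑ v ∈ t ∩ s, P.T.bary t v y = ∑ v ∈ s, P.T.bary t v y :=
        Finset.sum_subset Finset.inter_subset_right fun u hu hut =>
          Triangulation.bary_of_notMem fun h => hut (Finset.mem_inter.2 ⟨h, hu⟩)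
      rw [h3, hs1, Triangulation.sum_bary ht] at h2
      linarith
    intro v hvt hvs
    exact (Finset.sum_eq_zero_iff_of_nonneg fun v _ => hnn v).1 h1 v (by simp [hvt, hvs])
  have h5 := Triangulation.sum_bary_smul ht y
  rw [← h5, latticePoint, Finset.smul_sum]
  trans ∑ v ∈ s, P.T.bary t v y • v
  · rw [← Finset.sum_subset (Finset.inter_subset_left (s₁ := t) (s₂ := s)),
      ← Finset.sum_subset (Finset.inter_subset_right (s₁ := t) (s₂ := s))]
    · intro u hu hut
      rw [Triangulation.bary_of_notMem fun h => hut (Finset.mem_inter.2 ⟨h, hu⟩), zero_smul]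
    · intro u hu hut
      rw [hout u hu fun h => hut (Finset.mem_inter.2 ⟨hu, h⟩), zero_smul]
  · refine Finset.sum_congr rfl fun v hv => ?_
    rw [hbary v hv, mul_smul]

variable (P) in
theorem finite_nodes : P.nodes.Finite := by
  refine (P.T.elems.finite_toSet.biUnion (t := fun s => Set.range fun c : s → Fin (P.p + 1) =>
    (P.p : ℝ)⁻¹ • ∑ v : s, ((c v : ℕ) : ℝ) • (v : Pt d)) fun s _ => Set.finite_range _).subset ?_
  rintro _ ⟨s, hs, c, hc, rfl⟩
  refine Set.mem_biUnion hs ⟨fun v => ⟨c v, ?_⟩, ?_⟩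
  · rw [Nat.lt_succ_iff, ← hc]
    exact Finset.single_le_sum (f := c) (fun _ _ => Nat.zero_le _) v.2
  · exact congrArg _ (Finset.sum_coe_sort s fun v => (c v : ℝ) • v)

-- Normalized nodal functions show that taking values at the nodes in `Ω` maps `V_h` onto all value
-- vectors; a linear right inverse is the interpolation. Existence gives content to the choice in
-- `interp`.
variable (P) in
theorem exists_interpolation : ∃ L : (Pt d → ℝ) →ₗ[ℝ] P.Vh,
    ∀ (u : Pt d → ℝ), ∀ x ∈ P.nodes, x ∈ P.Ω → (L u : Pt d → ℝ) x = u x := by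
  classical
  let Z : Set (Pt d) := P.nodes ∩ P.Ω
  have : Fintype Z := (P.finite_nodes.subset Set.inter_subset_left).fintype
  let R : (Pt d → ℝ) →ₗ[ℝ] (Z → ℝ) := LinearMap.funLeft ℝ ℝ ((↑) : Z → Pt d)
  let E : P.Vh →ₗ[ℝ] (Z → ℝ) := R ∘ₗ P.Vh.subtype
  have hE : LinearMap.range E = ⊤ := by
    have hsingle : ∀ z : Z, Pi.single z (1 : ℝ) ∈ LinearMap.range E := by
      rintro ⟨z, ⟨s, hs, c, hc, rfl⟩, hz⟩
      refine ⟨(P.nodalFun s c (P.latticePoint s c))⁻¹ • ⟨_, nodalFun_mem_Vh hs hc hz⟩, ?_⟩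
      funext y
      change (P.nodalFun s c (P.latticePoint s c))⁻¹ * P.nodalFun s c y = _
      by_cases hy : (y : Pt d) = P.latticePoint s c
      · rw [hy, inv_mul_cancel₀ (nodalFun_self_ne_zero hs hc hz)]
        have : y = ⟨P.latticePoint s c, latticePoint_mem_nodes hs hc, hz⟩ := Subtype.ext hy
        rw [this]
        exact (Pi.single_eq_same (M := fun _ => ℝ) _ _).symm
      · rw [nodalFun_eq_zero hs hc hz y.2.1 y.2.2 hy, mul_zero]
        exact (Pi.single_eq_of_ne (M := fun _ => ℝ) (fun h => hy (congrArg Subtype.val h)) _).symm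
    refine eq_top_iff.2 fun u _ => ?_
    rw [pi_eq_sum_univ' u]
    refine Submodule.sum_mem _ fun z _ => Submodule.smul_mem _ _ ?_
    convert hsingle z using 1
  obtain ⟨g, hg⟩ := LinearMap.exists_rightInverse_of_surjective E hE
  refine ⟨g ∘ₗ R, fun u x hx hxΩ => ?_⟩
  exact congrFun (LinearMap.congr_fun hg (R u)) ⟨x, hx, hxΩ⟩

variable (P) in
theorem interp_apply (u : Pt d → ℝ) (hx : x ∈ P.nodes) (hxΩ : x ∈ P.Ω) :
    (P.interp u : Pt d → ℝ) x = u x :=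
  Classical.epsilon_spec P.exists_interpolation u x hx hxΩ

/-- A polynomial of degree at most `p` that vanishes at the nodes of an element is zero. -/
theorem eq_zero_of_latticePoint (hs : s ∈ P.T.elems) {q : MvPolynomial (Fin d) ℝ}
    (hq : q.totalDegree ≤ P.p)
    (h0 : ∀ c : Pt d → ℕ, ∑ v ∈ s, c v = P.p →
      MvPolynomial.eval (fun k => P.latticePoint s c k) q = 0) (x : Pt d) :
    MvPolynomial.eval (fun k => x k) q = 0 := by
  classical
  obtain ⟨v₀, hv₀⟩ : s.Nonempty := by
    rw [← Finset.card_pos, P.T.card_eq s hs]; omega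
  -- The affine map `y ↦ v₀ + p⁻¹ ∑ y_v (v - v₀)` takes lattice points of sum at most `p` to nodes
  -- of `s`. The index `v₀` is kept, as its term is zero; this avoids removing a vertex.
  let L : (s → ℝ) →ₗ[ℝ] (Fin d → ℝ) :=
    ∑ v : s, (LinearMap.proj v).smulRight fun k => (P.p : ℝ)⁻¹ * (v.1 k - v₀ k)
  have hL : ∀ y k, L y k = ∑ v : s, y v * ((P.p : ℝ)⁻¹ * (v.1 k - v₀ k)) := by
    intro y k
    simp [L]
  let Q : MvPolynomial s ℝ := MvPolynomial.bind₁ (fun k => MvPolynomial.C (v₀ k) +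
    ∑ v : s, MvPolynomial.X v * MvPolynomial.C ((P.p : ℝ)⁻¹ * (v.1 k - v₀ k))) q
  have hQ : ∀ y : s → ℝ, MvPolynomial.eval y Q =
      MvPolynomial.eval (L y + fun k => v₀ k) q := by
    intro y
    have h1 := MvPolynomial.aeval_bind₁ y (fun k => MvPolynomial.C (v₀ k) +
      ∑ v : s, MvPolynomial.X v * MvPolynomial.C ((P.p : ℝ)⁻¹ * (v.1 k - v₀ k))) q
    rw [MvPolynomial.aeval_eq_eval, MvPolynomial.aeval_eq_eval] at h1
    refine h1.trans ?_
    congr 2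
    funext k
    simp [hL, add_comm]
  have hQ0 : Q = 0 := by
    refine mvPolynomial_eq_zero_of_lattice Q fun c => ?_
    refine DiffDegreeLE.eq_zero_of_lattice (p := P.p) (f := fun y => MvPolynomial.eval y Q) ?_ ?_ c
    · simp only [hQ]
      exact ((diffDegreeLE_eval hq).translate (fun k => v₀ k)).comp_addMonoidHom L.toAddMonoidHom
    · intro c hc
      -- The vertex `v₀` receives the missing weight, so that the weights add up to `p`.
      let e : Pt d → ℕ := fun v =>
        if h : v ∈ s then (if v = v₀ then c ⟨v, h⟩ + (P.p - ∑ i, c i) else c ⟨v, h⟩) else 0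
      have he : ∀ v : s, e v = c v + if v = ⟨v₀, hv₀⟩ then P.p - ∑ i, c i else 0 := by
        intro v
        by_cases hv : v = ⟨v₀, hv₀⟩
        · subst hv; simp [e, hv₀]
        · have : v.1 ≠ v₀ := fun h => hv (Subtype.ext h)
          simp [e, hv, this]
      have hesum : ∑ v ∈ s, e v = P.p := by
        rw [← Finset.sum_coe_sort]
        simp only [he, Finset.sum_add_distrib, Finset.sum_ite_eq', Finset.mem_univ, if_true]
        omega
      rw [hQ, ← h0 e hesum]
      congr 2
      funext k
      have hp := P.cast_p_ne_zero
      have h3 : ((P.p - ∑ i, c i : ℕ) : ℝ) = P.p - ∑ i, (c i : ℝ) := by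
        rw [Nat.cast_sub hc, Nat.cast_sum]
      have h2 : P.latticePoint s e k =
          (P.p : ℝ)⁻¹ * (∑ v : s, (c v : ℝ) * v.1 k + (P.p - ∑ i, (c i : ℝ)) * v₀ k) := by
        rw [latticePoint, ← Finset.sum_coe_sort, ← h3]
        simp [he, add_mul, Finset.sum_add_distrib]
      rw [h2, Pi.add_apply, hL]
      simp only [mul_sub, Finset.sum_sub_distrib]
      rw [← Finset.sum_mul (f := fun v : s => (c v : ℝ)), mul_add, Finset.mul_sum]
      rw [← sub_eq_zero]
      simp only [mul_left_comm (P.p : ℝ)⁻¹]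
      field_simp
      ring
  let y : s → ℝ := fun v => P.p * P.T.bary s v x
  have hy := hQ y
  rw [hQ0, map_zero] at hy
  rw [hy]
  congr 2
  funext k
  have hx := congrArg (fun x : Pt d => x k) (Triangulation.sum_bary_smul hs x)
  have hone := Triangulation.sum_bary hs x
  rw [← Finset.sum_coe_sort] at hx hone
  simp only [WithLp.ofLp_sum, Finset.sum_apply, WithLp.ofLp_smul, Pi.smul_apply, smul_eq_mul] at hx
  rw [Pi.add_apply, hL, ← hx]
  have hterm : ∀ v : s, y v * ((P.p : ℝ)⁻¹ * (v.1 k - v₀ k)) =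
      P.T.bary s v x * v.1 k - P.T.bary s v x * v₀ k := by
    intro v
    have hp := P.cast_p_ne_zero
    simp only [y]
    field_simp
  simp only [hterm, Finset.sum_sub_distrib]
  rw [← Finset.sum_mul, hone]
  ring

theorem Vh_eq_zero_on_elem (hs : s ∈ P.T.elems) {v : Pt d → ℝ} (hv : v ∈ P.Vh)
    (h0 : ∀ z ∈ P.nodes, z ∈ P.Ω → z ∈ convexHull ℝ (s : Set (Pt d)) → v z = 0)
    (hx : x ∈ convexHull ℝ (s : Set (Pt d))) : v x = 0 := by
  obtain ⟨q, hq, hqv⟩ := hv.2.2 s hs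
  rw [hqv x hx]
  refine eq_zero_of_latticePoint hs hq (fun c hc => ?_) x
  have hmem := latticePoint_mem hs hc
  rw [← hqv _ hmem]
  by_cases hz : P.latticePoint s c ∈ P.Ω
  · exact h0 _ (latticePoint_mem_nodes hs hc) hz hmem
  · exact hv.2.1 _ hz

theorem Vh_ext {u v : P.Vh}
    (h : ∀ z ∈ P.nodes, z ∈ P.Ω → (u : Pt d → ℝ) z = (v : Pt d → ℝ) z) : u = v := by
  rw [← sub_eq_zero]
  refine Subtype.ext (funext fun x => ?_)
  by_cases hx : x ∈ P.Ω
  · obtain ⟨s, hs, hxs⟩ := P.T.exists_mem_elems (subset_closure hx)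
    refine Vh_eq_zero_on_elem hs (u - v).2 (fun z hz hzΩ _ => ?_) hxs
    change (u : Pt d → ℝ) z - (v : Pt d → ℝ) z = 0
    rw [h z hz hzΩ, sub_self]
  · exact (u - v).2.2.1 x hx

end Setting

/-! ### Resolved sets and the partition of unity operators -/

namespace Triangulation

variable {d : ℕ} {Ω : Set (Pt d)} {T : Triangulation Ω} {s : Finset (Pt d)} {ω : Set (Pt d)}
  {T' : Finset (Finset (Pt d))}

theorem closure_interior_iUnion (hT' : T' ⊆ T.elems) :
    closure (interior (⋃ s ∈ T', convexHull ℝ (s : Set (Pt d)))) =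
      ⋃ s ∈ T', convexHull ℝ (s : Set (Pt d)) := by
  refine subset_antisymm (closure_minimal interior_subset ?_) ?_
  · exact Set.Finite.isClosed_biUnion T'.finite_toSet fun s _ => isClosed_convexHull s
  · refine Set.iUnion₂_subset fun s hs => ?_
    rw [← closure_interior_convexHull (hT' hs)]
    exact closure_mono (interior_mono (Set.subset_biUnion_of_mem
      (u := fun s : Finset (Pt d) => convexHull ℝ (s : Set (Pt d))) hs))

/-- The interior of `s` meets no other element, and an open set that misses this interior also
misses its closure, which is the whole element. -/
theorem disjoint_of_notMem (hT' : T' ⊆ T.elems) (hs : s ∈ T.elems) (hsT' : s ∉ T') :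
    Disjoint (convexHull ℝ (s : Set (Pt d)))
      (interior (⋃ s ∈ T', convexHull ℝ (s : Set (Pt d)))) := by
  rw [← closure_interior_convexHull hs]
  refine Disjoint.closure_left ?_ isOpen_interior
  rw [Set.disjoint_left]
  intro x hxs hx
  obtain ⟨t, ht, hxt⟩ : ∃ t ∈ T', x ∈ convexHull ℝ (t : Set (Pt d)) := by
    simpa using interior_subset hx
  exact hsT' (eq_of_mem_interior hs (hT' ht) hxs hxt ▸ ht)

theorem Resolves.isOpen (h : T.Resolves ω) : IsOpen ω := by
  obtain ⟨T', -, rfl⟩ := h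
  exact isOpen_interior

theorem Resolves.interior_closure (h : T.Resolves ω) : interior (closure ω) = ω := by
  obtain ⟨T', hT', rfl⟩ := h
  rw [closure_interior_iUnion hT']

variable (T) in
theorem volume_frontiers :
    volume (⋃ s ∈ T.elems, frontier (convexHull ℝ (s : Set (Pt d)))) = 0 :=
  (measure_biUnion_null_iff T.elems.countable_toSet).2 fun s _ =>
    (convex_convexHull ℝ (s : Set (Pt d))).addHaar_frontier volume

theorem Resolves.volume_closure_diff (h : T.Resolves ω) : volume (closure ω \ ω) = 0 := by
  refine measure_mono_null ?_ T.volume_frontiers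
  obtain ⟨T', hT', rfl⟩ := h
  rintro x ⟨hx, hx'⟩
  rw [closure_interior_iUnion hT'] at hx
  obtain ⟨s, hs, hxs⟩ := Set.mem_iUnion₂.1 hx
  refine Set.mem_biUnion (hT' hs) ⟨subset_closure hxs, fun hi => hx' ?_⟩
  exact interior_mono (Set.subset_biUnion_of_mem
    (u := fun s : Finset (Pt d) => convexHull ℝ (s : Set (Pt d))) hs) hi

variable (T) in
theorem ae_mem_interior (hΩ : MeasurableSet Ω) : ∀ᵐ x ∂volume.restrict Ω,
    ∃ s ∈ T.elems, x ∈ interior (convexHull ℝ (s : Set (Pt d))) := by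
  rw [ae_restrict_iff' hΩ]
  filter_upwards [measure_eq_zero_iff_ae_notMem.1 T.volume_frontiers] with x hx hxΩ
  obtain ⟨s, hs, hxs⟩ := T.exists_mem_elems (subset_closure hxΩ)
  refine ⟨s, hs, ?_⟩
  by_contra h
  exact hx (Set.mem_biUnion hs ⟨subset_closure hxs, h⟩)

end Triangulation

namespace Setting

variable {d : ℕ} (P : Setting d)

theorem Resolves.subset {ω : Set (Pt d)} (h : P.T.Resolves ω) : ω ⊆ P.Ω := by
  obtain ⟨T', hT', rfl⟩ := h
  rw [← P.interior_closure_Ω, P.T.cover]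
  exact interior_mono (Set.biUnion_subset_biUnion_left hT')

theorem ω_subset (i : Fin P.M) : P.ω i ⊆ P.Ω := Resolves.subset P (P.resolves_ω i)

theorem ωs_subset (i : Fin P.M) : P.ωs i ⊆ P.Ω := Resolves.subset P (P.resolves_ωs i)

/-- The support condition only gives the closure of `ω i`. By continuity the set where `χ i` is
nonzero is open in `Ω`, so it lies in the interior of that closure, which is `ω i` for a resolved
set. -/
theorem χ_eq_zero {i : Fin P.M} {x : Pt d} (hx : x ∈ P.Ω) (hxi : x ∉ P.ω i) : P.χ i x = 0 := by
  by_contra h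
  refine hxi ?_
  rw [← (P.resolves_ω i).interior_closure, mem_interior_iff_mem_nhds]
  have hc := (P.continuousOn_χ i).continuousAt (P.isOpen_Ω.mem_nhds hx)
  filter_upwards [hc.eventually_ne h] with y hy
  exact P.tsupport_χ i (subset_tsupport _ hy)

/-- Interpolation of functions that vanish outside a resolved set `ω`. -/
theorem interp_mem_Vh0 {ω : Set (Pt d)} (hω : P.T.Resolves ω) {u : Pt d → ℝ}
    (hu : ∀ x ∉ ω, u x = 0) : P.interp u ∈ P.Vh0 ω := by
  obtain ⟨T', hT', rfl⟩ := hω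
  change closure _ ⊆ _
  rw [Triangulation.closure_interior_iUnion hT']
  refine closure_minimal ?_ (Set.Finite.isClosed_biUnion T'.finite_toSet
    fun s _ => Triangulation.isClosed_convexHull s)
  intro x hx
  have hxΩ : x ∈ P.Ω := by
    by_contra h
    exact hx ((P.interp u).2.2.1 x h)
  obtain ⟨s, hs, hxs⟩ := P.T.exists_mem_elems (subset_closure hxΩ)
  by_cases hsT' : s ∈ T'
  · exact Set.mem_biUnion (t := fun s : Finset (Pt d) => convexHull ℝ (s : Set (Pt d))) hsT' hxs
  · refine (hx (Vh_eq_zero_on_elem hs (P.interp u).2 (fun z hz hzΩ hzs => ?_) hxs)).elim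
    rw [P.interp_apply u hz hzΩ]
    exact hu z (Set.disjoint_left.1 (Triangulation.disjoint_of_notMem hT' hs hsT') hzs)

theorem VhLoc_eq_zero {ω : Set (Pt d)} (w : P.VhLoc ω) {x : Pt d} (hx : x ∉ ω) :
    (w : Pt d → ℝ) x = 0 := by
  obtain ⟨v, -, hv⟩ := w.2
  rw [← hv]
  exact Set.indicator_of_notMem hx v

/-- The choice in `chi` is met because the product vanishes off `ω i`, and its interpolant therefore
belongs to `V_{h,0}(ω_i)`. -/
theorem chi_apply (i : Fin P.M) (w : P.VhLoc (P.ω i)) :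
    (P.chi i w : P.Vh) = P.interp fun x => P.χ i x * (w : Pt d → ℝ) x := by
  refine Classical.epsilon_spec (p := fun L : P.VhLoc (P.ω i) →ₗ[ℝ] P.Vh0 (P.ω i) =>
    ∀ w, (L w : P.Vh) = P.interp fun x => P.χ i x * (w : Pt d → ℝ) x) ⟨?_, ?_⟩ w
  · exact (P.interp ∘ₗ LinearMap.mulLeft ℝ (P.χ i) ∘ₗ (P.VhLoc (P.ω i)).subtype).codRestrict
      (P.Vh0 (P.ω i)) fun w => P.interp_mem_Vh0 (P.resolves_ω i) fun x hx => by
        simp [P.VhLoc_eq_zero w hx]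
  · intro w
    rfl

theorem toLoc_apply (ω : Set (Pt d)) (v : P.Vh) :
    (P.toLoc ω v : Pt d → ℝ) = ω.indicator v := rfl

theorem locRestr_toLoc (i : Fin P.M) (v : P.Vh) :
    P.locRestr i (P.toLoc (P.ωs i) v) = P.toLoc (P.ω i) v := by
  refine Subtype.ext ?_
  change (P.ω i).indicator ((P.ωs i).indicator (v : Pt d → ℝ)) = (P.ω i).indicator v
  rw [Set.indicator_indicator, Set.inter_eq_left.mpr (P.ω_subset_ωs i)]

/-- The partition of unity operator as a map of `V_h` to itself. -/
def pouOp (i : Fin P.M) : P.Vh →ₗ[ℝ] P.Vh :=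
  (P.Vh0 (P.ω i)).subtype ∘ₗ P.chi i ∘ₗ P.toLoc (P.ω i)

theorem pouOp_mem (i : Fin P.M) (v : P.Vh) : P.pouOp i v ∈ P.Vh0 (P.ω i) :=
  (P.chi i (P.toLoc (P.ω i) v)).2

/-- Both sides have the same nodal values, since the `χ i` add up to one. -/
theorem sum_pouOp (v : P.Vh) : ∑ i, P.pouOp i v = v := by
  refine Vh_ext fun z hz hzΩ => ?_
  rw [AddSubmonoidClass.coe_finsetSum, Finset.sum_apply]
  have h : ∀ i, (P.pouOp i v : Pt d → ℝ) z = P.χ i z * (v : Pt d → ℝ) z := by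
    intro i
    change ((P.chi i (P.toLoc (P.ω i) v) : P.Vh) : Pt d → ℝ) z = _
    rw [P.chi_apply, P.interp_apply _ hz hzΩ, toLoc_apply]
    by_cases hzi : z ∈ P.ω i
    · rw [Set.indicator_of_mem hzi]
    · rw [P.χ_eq_zero hzΩ hzi, zero_mul, zero_mul]
  simp only [h]
  rw [← Finset.sum_mul, P.sum_χ z hzΩ, one_mul]

end Setting

/-! ### The energy form -/

/-- For a symmetric positive semidefinite form, the energy of a sum is at most the number of
summands times the sum of the energies. -/
theorem bilinForm_sum_le {ι E : Type*} [AddCommGroup E] [Module ℝ E] (B : LinearMap.BilinForm ℝ E)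
    (hsymm : ∀ x y, B x y = B y x) (hnn : ∀ x, 0 ≤ B x x) (I : Finset ι) (g : ι → E) :
    B (∑ i ∈ I, g i) (∑ i ∈ I, g i) ≤ I.card * ∑ i ∈ I, B (g i) (g i) := by
  have h : ∀ x y, B x y ≤ (B x x + B y y) / 2 := by
    intro x y
    have := hnn (x - y)
    simp only [map_sub, LinearMap.sub_apply, hsymm y x] at this
    linarith
  simp only [map_sum, LinearMap.sum_apply]
  rw [Finset.sum_comm]
  refine (Finset.sum_le_sum fun i _ => Finset.sum_le_sum fun j _ => h (g i) (g j)).trans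
    (le_of_eq ?_)
  simp only [← Finset.sum_div, Finset.sum_add_distrib, Finset.sum_const, nsmul_eq_mul,
    ← Finset.mul_sum]
  ring

theorem contDiff_mvPolynomial_eval {d : ℕ} (q : MvPolynomial (Fin d) ℝ) :
    ContDiff ℝ 1 fun x : Pt d => MvPolynomial.eval (fun k => x k) q := by
  simp only [MvPolynomial.eval_eq']
  fun_prop

theorem measurable_gradient {d : ℕ} (v : Pt d → ℝ) : Measurable (gradient v) :=
  (InnerProductSpace.toDual ℝ (Pt d)).symm.continuous.measurable.comp (measurable_fderiv ℝ v)

theorem gradient_congr {d : ℕ} {u v : Pt d → ℝ} {x : Pt d} (h : u =ᶠ[nhds x] v) :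
    gradient u x = gradient v x := by
  rw [gradient, gradient, h.fderiv_eq]

theorem gradient_add_apply {d : ℕ} {u v : Pt d → ℝ} {x : Pt d} (hu : DifferentiableAt ℝ u x)
    (hv : DifferentiableAt ℝ v x) : gradient (u + v) x = gradient u x + gradient v x := by
  rw [gradient, gradient, gradient, fderiv_add hu hv, map_add]

theorem gradient_smul_apply {d : ℕ} {u : Pt d → ℝ} {x : Pt d} (c : ℝ)
    (hu : DifferentiableAt ℝ u x) : gradient (c • u) x = c • gradient u x := by
  rw [gradient, gradient, fderiv_const_smul hu]
  simp

namespace Setting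

variable {d : ℕ} (P : Setting d)

/-- The bilinear form of the coefficient at the point `x`. -/
def coeffForm (x : Pt d) : LinearMap.BilinForm ℝ (Pt d) :=
  LinearMap.mk₂ ℝ (fun ζ η => (P.coeff x *ᵥ ζ.ofLp) ⬝ᵥ η.ofLp)
    (fun ζ ζ' η => by simp [Matrix.mulVec_add, add_dotProduct])
    (fun c ζ η => by simp [Matrix.mulVec_smul])
    (fun ζ η η' => by simp [dotProduct_add])
    (fun c ζ η => by simp)

variable {P} {x : Pt d} {ω : Set (Pt d)}

theorem coeffForm_apply (ζ η : Pt d) :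
    P.coeffForm x ζ η = (P.coeff x *ᵥ ζ.ofLp) ⬝ᵥ η.ofLp := rfl

theorem a_eq (ω : Set (Pt d)) (u v : Pt d → ℝ) :
    P.a ω u v = ∫ x in ω, P.coeffForm x (gradient u x) (gradient v x) := rfl

theorem coeffForm_symm (hx : x ∈ P.Ω) (ζ η : Pt d) :
    P.coeffForm x ζ η = P.coeffForm x η ζ := by
  rw [coeffForm_apply, coeffForm_apply, dotProduct_comm, Matrix.dotProduct_mulVec,
    ← Matrix.mulVec_transpose, (P.symm_coeff x hx).eq]

theorem dotProduct_self_eq (ζ : Pt d) : ζ.ofLp ⬝ᵥ ζ.ofLp = ‖ζ‖ ^ 2 := by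
  rw [EuclideanSpace.real_norm_sq_eq, dotProduct]
  exact Finset.sum_congr rfl fun k _ => (sq _).symm

theorem le_coeffForm_self (hx : x ∈ P.Ω) (ζ : Pt d) : P.α * ‖ζ‖ ^ 2 ≤ P.coeffForm x ζ ζ := by
  rw [← dotProduct_self_eq]
  exact (P.elliptic_coeff x hx ζ.ofLp).1

theorem coeffForm_self_nonneg (hx : x ∈ P.Ω) (ζ : Pt d) : 0 ≤ P.coeffForm x ζ ζ :=
  (mul_nonneg P.α_pos.le (sq_nonneg _)).trans (le_coeffForm_self hx ζ)

theorem abs_coeffForm_le (hx : x ∈ P.Ω) (ζ η : Pt d) :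
    |P.coeffForm x ζ η| ≤ |P.β| * (‖ζ‖ ^ 2 + ‖η‖ ^ 2) := by
  have hup : ∀ ζ : Pt d, P.coeffForm x ζ ζ ≤ |P.β| * ‖ζ‖ ^ 2 := by
    intro ζ
    have := (P.elliptic_coeff x hx ζ.ofLp).2
    rw [dotProduct_self_eq] at this
    exact this.trans (mul_le_mul_of_nonneg_right (le_abs_self _) (sq_nonneg _))
  have h1 := coeffForm_self_nonneg hx (ζ - η)
  have h2 := coeffForm_self_nonneg hx (ζ + η)
  simp only [map_sub, map_add, LinearMap.sub_apply, LinearMap.add_apply,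
    coeffForm_symm hx η ζ] at h1 h2
  have h3 := hup ζ
  have h4 := hup η
  have h5 := coeffForm_self_nonneg hx ζ
  have h6 := coeffForm_self_nonneg hx η
  rw [abs_le]
  constructor <;> nlinarith

/-! #### Regularity of finite element functions -/

theorem differentiableAt_of_mem_interior {s : Finset (Pt d)} (hs : s ∈ P.T.elems)
    (hx : x ∈ interior (convexHull ℝ (s : Set (Pt d)))) (v : P.Vh) :
    DifferentiableAt ℝ (v : Pt d → ℝ) x := by
  obtain ⟨q, -, hq⟩ := v.2.2.2 s hs
  refine ((contDiff_mvPolynomial_eval q).differentiable one_ne_zero x).congr_of_eventuallyEq ?_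
  filter_upwards [mem_interior_iff_mem_nhds.1 hx] with y hy using hq y hy

theorem continuousOn_gradient {s : Finset (Pt d)} (hs : s ∈ P.T.elems) (v : P.Vh) :
    ∃ g : Pt d → Pt d, Continuous g ∧
      ∀ x ∈ interior (convexHull ℝ (s : Set (Pt d))), gradient (v : Pt d → ℝ) x = g x := by
  obtain ⟨q, -, hq⟩ := v.2.2.2 s hs
  refine ⟨gradient fun x : Pt d => MvPolynomial.eval (fun k => x k) q, ?_, fun x hx => ?_⟩
  · exact (InnerProductSpace.toDual ℝ (Pt d)).symm.continuous.comp
      ((contDiff_mvPolynomial_eval q).continuous_fderiv one_ne_zero)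
  · refine gradient_congr ?_
    filter_upwards [mem_interior_iff_mem_nhds.1 hx] with y hy using hq y hy

variable (P) in
theorem ae_mem_interior : ∀ᵐ x ∂volume.restrict P.Ω,
    ∃ s ∈ P.T.elems, x ∈ interior (convexHull ℝ (s : Set (Pt d))) :=
  P.T.ae_mem_interior P.isOpen_Ω.measurableSet

variable (P) in
theorem ae_differentiableAt : ∀ᵐ x ∂volume.restrict P.Ω,
    ∀ v : P.Vh, DifferentiableAt ℝ (v : Pt d → ℝ) x := by
  filter_upwards [P.ae_mem_interior] with x ⟨s, hs, hx⟩ v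
  exact differentiableAt_of_mem_interior hs hx v

theorem ae_gradient_le (v : P.Vh) :
    ∃ C, ∀ᵐ x ∂volume.restrict P.Ω, ‖gradient (v : Pt d → ℝ) x‖ ≤ C := by
  have h : ∀ s : Finset (Pt d), ∃ C, s ∈ P.T.elems →
      ∀ x ∈ interior (convexHull ℝ (s : Set (Pt d))), ‖gradient (v : Pt d → ℝ) x‖ ≤ C := by
    intro s
    by_cases hs : s ∈ P.T.elems
    · obtain ⟨g, hg, hgv⟩ := continuousOn_gradient hs v
      obtain ⟨C, hC⟩ := (s.finite_toSet.isCompact_convexHull ℝ).exists_bound_of_continuousOn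
        hg.continuousOn
      exact ⟨C, fun _ x hx => by rw [hgv x hx]; exact hC x (interior_subset hx)⟩
    · exact ⟨0, fun h => (hs h).elim⟩
  choose C hC using h
  refine ⟨∑ s ∈ P.T.elems, |C s|, ?_⟩
  filter_upwards [P.ae_mem_interior] with x ⟨s, hs, hx⟩
  exact (hC s hs x hx).trans ((le_abs_self _).trans
    (Finset.single_le_sum (f := fun s => |C s|) (fun _ _ => abs_nonneg _) hs))

variable (P) in
theorem isCompact_closure_Ω : IsCompact (closure P.Ω) := by
  rw [P.T.cover]
  exact P.T.elems.finite_toSet.isCompact_biUnion fun s _ => s.finite_toSet.isCompact_convexHull ℝ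

theorem integrable_energy (u v : P.Vh) : IntegrableOn (fun x =>
    P.coeffForm x (gradient (u : Pt d → ℝ) x) (gradient (v : Pt d → ℝ) x)) P.Ω := by
  obtain ⟨C, hC⟩ := ae_gradient_le u
  obtain ⟨D, hD⟩ := ae_gradient_le v
  have hfin : volume P.Ω ≠ ∞ :=
    ((measure_mono subset_closure).trans_lt P.isCompact_closure_Ω.measure_lt_top).ne
  have : IsFiniteMeasure (volume.restrict P.Ω) := ⟨by simpa using hfin.lt_top⟩
  refine Integrable.of_bound ?_ (|P.β| * (C ^ 2 + D ^ 2)) ?_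
  · refine AEMeasurable.aestronglyMeasurable ?_
    have hcomp : ∀ (w : P.Vh) (k : Fin d),
        AEMeasurable (fun x => (gradient (w : Pt d → ℝ) x).ofLp k) (volume.restrict P.Ω) := by
      intro w k
      have : Measurable fun y : Pt d => y.ofLp k := by fun_prop
      exact (this.comp (measurable_gradient _)).aemeasurable
    simp only [coeffForm_apply, dotProduct, Matrix.mulVec]
    refine Finset.aemeasurable_fun_sum _ fun k _ => AEMeasurable.mul ?_ (hcomp v k)
    exact Finset.aemeasurable_fun_sum _ fun l _ => (P.measurable_coeff k l).mul (hcomp u l)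
  · filter_upwards [hC, hD, ae_restrict_mem P.isOpen_Ω.measurableSet] with x h1 h2 hx
    refine (abs_coeffForm_le hx _ _).trans ?_
    gcongr

variable (P) in
/-- The form `a_ω` on `V_h`. -/
def aForm (hω : ω ⊆ P.Ω) : LinearMap.BilinForm ℝ P.Vh :=
  have hd := ae_mono (Measure.restrict_mono_set volume hω) P.ae_differentiableAt
  LinearMap.mk₂ ℝ (fun u v => P.a ω u v)
    (fun u u' v => by
      simp only [a_eq]
      rw [← integral_add ((integrable_energy u v).mono_set hω)
        ((integrable_energy u' v).mono_set hω)]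
      refine integral_congr_ae ?_
      filter_upwards [hd] with x hx
      rw [Submodule.coe_add, gradient_add_apply (hx u) (hx u'), map_add, LinearMap.add_apply])
    (fun c u v => by
      simp only [a_eq]
      rw [smul_eq_mul, ← integral_const_mul]
      refine integral_congr_ae ?_
      filter_upwards [hd] with x hx
      rw [Submodule.coe_smul, gradient_smul_apply c (hx u), map_smul, LinearMap.smul_apply,
        smul_eq_mul])
    (fun u v v' => by
      simp only [a_eq]
      rw [← integral_add ((integrable_energy u v).mono_set hω)
        ((integrable_energy u v').mono_set hω)]
      refine integral_congr_ae ?_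
      filter_upwards [hd] with x hx
      rw [Submodule.coe_add, gradient_add_apply (hx v) (hx v'), map_add])
    (fun c u v => by
      simp only [a_eq]
      rw [smul_eq_mul, ← integral_const_mul]
      refine integral_congr_ae ?_
      filter_upwards [hd] with x hx
      rw [Submodule.coe_smul, gradient_smul_apply c (hx v), map_smul, smul_eq_mul])

theorem aForm_apply (hω : ω ⊆ P.Ω) (u v : P.Vh) : P.aForm hω u v = P.a ω u v := rfl

theorem aForm_symm (hω : ω ⊆ P.Ω) (hm : MeasurableSet ω) (u v : P.Vh) :
    P.aForm hω u v = P.aForm hω v u :=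
  setIntegral_congr_fun hm fun _ hx => coeffForm_symm (hω hx) _ _

theorem aForm_self_nonneg (hω : ω ⊆ P.Ω) (hm : MeasurableSet ω) (u : P.Vh) :
    0 ≤ P.aForm hω u u :=
  setIntegral_nonneg hm fun _ hx => coeffForm_self_nonneg (hω hx) _

theorem gradient_indicator (hω : IsOpen ω) (u : Pt d → ℝ) (hx : x ∈ ω) :
    gradient (ω.indicator u) x = gradient u x := by
  refine gradient_congr ?_
  filter_upwards [hω.mem_nhds hx] with y hy using Set.indicator_of_mem hy u

theorem a_indicator_left (hω : IsOpen ω) (u v : Pt d → ℝ) :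
    P.a ω (ω.indicator u) v = P.a ω u v :=
  setIntegral_congr_fun hω.measurableSet fun x hx => by
    dsimp only
    rw [gradient_indicator hω u hx]

theorem a_indicator_right (hω : IsOpen ω) (u v : Pt d → ℝ) :
    P.a ω u (ω.indicator v) = P.a ω u v :=
  setIntegral_congr_fun hω.measurableSet fun x hx => by
    dsimp only
    rw [gradient_indicator hω v hx]

theorem ae_gradient_eq_zero (hω : P.T.Resolves ω) {v : P.Vh} (hv : v ∈ P.Vh0 ω) :
    ∀ᵐ x, x ∉ ω → gradient (v : Pt d → ℝ) x = 0 := by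
  filter_upwards [measure_eq_zero_iff_ae_notMem.1 hω.volume_closure_diff] with x hx hxω
  have hxc : x ∉ tsupport (v : Pt d → ℝ) := fun h => hx ⟨hv h, hxω⟩
  have h0 : (v : Pt d → ℝ) =ᶠ[nhds x] fun _ => 0 := notMem_tsupport_iff_eventuallyEq.1 hxc
  rw [gradient_congr h0, gradient]
  simp

theorem a_eq_of_mem_Vh0 (hω : P.T.Resolves ω) (u : P.Vh) {v : P.Vh} (hv : v ∈ P.Vh0 ω) :
    P.a P.Ω u v = P.a ω u v := by
  rw [a_eq, a_eq]
  refine setIntegral_eq_of_subset_of_ae_sdiff_eq_zero P.isOpen_Ω.measurableSet.nullMeasurableSet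
    (Resolves.subset P hω) (f := fun x => P.coeffForm x (gradient (u : Pt d → ℝ) x)
      (gradient (v : Pt d → ℝ) x)) (μ := volume) ?_
  filter_upwards [ae_gradient_eq_zero hω hv] with x hx hxd
  rw [hx hxd.2, map_zero]

/-- The gradient vanishes almost everywhere, so `v` is constant on each element and takes finitely
many values. A continuous function on the connected space with finite range is constant, and `v` is
zero outside the bounded set `Ω`. No Poincaré inequality is needed. -/
theorem eq_zero_of_a_self_eq_zero (hd : d ≠ 0) {v : P.Vh} (hv : P.a P.Ω v v = 0) : v = 0 := by
  have hm := P.isOpen_Ω.measurableSet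
  have hgrad : ∀ᵐ x ∂volume.restrict P.Ω, gradient (v : Pt d → ℝ) x = 0 := by
    have h0 := (setIntegral_eq_zero_iff_of_nonneg_ae
      ((ae_restrict_mem hm).mono fun x hx => coeffForm_self_nonneg hx _)
      (integrable_energy v v)).1 hv
    filter_upwards [h0, ae_restrict_mem hm] with x hx hxΩ
    have h1 := le_coeffForm_self hxΩ (gradient (v : Pt d → ℝ) x)
    rw [hx, Pi.zero_apply] at h1
    have h2 : ‖gradient (v : Pt d → ℝ) x‖ ^ 2 ≤ 0 := by
      by_contra! h
      exact (mul_pos P.α_pos h).not_ge h1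
    simpa using h2
  have hconst : ∀ s ∈ P.T.elems, ∃ c, ∀ x ∈ convexHull ℝ (s : Set (Pt d)),
      (v : Pt d → ℝ) x = c := by
    intro s hs
    set U := interior (convexHull ℝ (s : Set (Pt d))) with hU
    have hUo : IsOpen U := isOpen_interior
    have hUΩ : U ⊆ P.Ω := by
      rw [← P.interior_closure_Ω]
      exact interior_mono (Triangulation.convexHull_subset_closure hs)
    obtain ⟨g, hg, hgv⟩ := continuousOn_gradient hs v
    have hg0 : Set.EqOn g 0 U := by
      refine Measure.eqOn_open_of_ae_eq (μ := volume) ?_ hUo hg.continuousOn continuousOn_const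
      filter_upwards [ae_mono (Measure.restrict_mono_set volume hUΩ) hgrad,
        ae_restrict_mem hUo.measurableSet] with x hx hxU
      rw [← hgv x hxU, hx, Pi.zero_apply]
    obtain ⟨x₀, hx₀⟩ := Triangulation.nonempty_interior_convexHull hs
    refine ⟨(v : Pt d → ℝ) x₀, fun x hx => ?_⟩
    have hconv : Convex ℝ U := (convex_convexHull ℝ _).interior
    have hfd : ∀ y ∈ U, fderiv ℝ (v : Pt d → ℝ) y = 0 := by
      intro y hy
      have h := hgv y hy
      rw [hg0 hy, gradient, Pi.zero_apply] at h
      simpa using h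
    have hon : Set.EqOn (v : Pt d → ℝ) (fun _ => (v : Pt d → ℝ) x₀) U := fun y hy =>
      hUo.is_const_of_fderiv_eq_zero hconv.isPreconnected
        (fun z hz => (differentiableAt_of_mem_interior hs hz v).differentiableWithinAt)
        hfd hy hx₀
    have := hon.closure v.2.1 continuous_const
    rw [hU, Triangulation.closure_interior_convexHull hs] at this
    exact this hx
  choose! c hc using hconst
  have hfin : (Set.range (v : Pt d → ℝ)).Finite := by
    refine ((P.T.elems.finite_toSet.image c).union (Set.finite_singleton 0)).subset ?_
    rintro _ ⟨x, rfl⟩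
    by_cases hx : x ∈ P.Ω
    · obtain ⟨s, hs, hxs⟩ := P.T.exists_mem_elems (subset_closure hx)
      exact Or.inl ⟨s, hs, (hc s hs x hxs).symm⟩
    · exact Or.inr (v.2.2.1 x hx)
  -- Positive dimension matters here: in dimension zero `Ω` is the whole space.
  obtain ⟨x₀, hx₀⟩ : ∃ x₀, x₀ ∉ P.Ω := by
    by_contra! h
    have : Nonempty (Fin d) := ⟨⟨0, Nat.pos_of_ne_zero hd⟩⟩
    have : NoncompactSpace (Pt d) := NormedSpace.noncompactSpace ℝ (Pt d)
    refine noncompact_univ (Pt d) ?_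
    have h1 := P.isCompact_closure_Ω
    rwa [Set.eq_univ_of_forall h, closure_univ] at h1
  have hsub : (Set.range (v : Pt d → ℝ)).Subsingleton :=
    hfin.countable.isTotallyDisconnected _ subset_rfl (isPreconnected_range v.2.1)
  refine Subtype.ext (funext fun x => ?_)
  exact (hsub ⟨x, rfl⟩ ⟨x₀, rfl⟩).trans (v.2.2.1 x₀ hx₀)

/-! #### Overlap -/

theorem ncard_le_overlap (D : Fin P.M → Set (Pt d)) (hx : x ∈ P.Ω) :
    {i | x ∈ D i}.ncard ≤ P.overlap D := by
  refine le_csSup ⟨P.M, ?_⟩ ⟨x, hx, rfl⟩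
  rintro _ ⟨y, -, rfl⟩
  simpa using Set.ncard_le_ncard (Set.subset_univ {i | y ∈ D i})

open Classical in
theorem card_filter_le_overlap (D : Fin P.M → Set (Pt d)) (hx : x ∈ P.Ω) :
    (Finset.univ.filter fun i => x ∈ D i).card ≤ P.overlap D := by
  rw [← Set.ncard_coe_finset]
  simpa using ncard_le_overlap D hx

variable (P) in
theorem overlap_ω_ne_zero : P.overlap P.ω ≠ 0 := by
  obtain ⟨x, hx⟩ := P.isConnected_Ω.nonempty
  obtain ⟨i, hi⟩ : ∃ i, x ∈ P.ω i := by
    rw [← P.iUnion_ω] at hx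
    simpa using hx
  have h := ncard_le_overlap P.ω hx
  have h0 : 0 < {i | x ∈ P.ω i}.ncard := (Set.ncard_pos (Set.toFinite _)).2 ⟨i, hi⟩
  omega

variable (P) in
theorem overlap_ωs_ne_zero : P.overlap P.ωs ≠ 0 := by
  obtain ⟨x, hx⟩ := P.isConnected_Ω.nonempty
  obtain ⟨i, hi⟩ : ∃ i, x ∈ P.ω i := by
    rw [← P.iUnion_ω] at hx
    simpa using hx
  have h := ncard_le_overlap P.ωs hx
  have h0 : 0 < {i | x ∈ P.ωs i}.ncard :=
    (Set.ncard_pos (Set.toFinite _)).2 ⟨i, P.ω_subset_ωs i hi⟩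
  omega

theorem sum_a_le (D : Fin P.M → Set (Pt d)) (hD : ∀ i, D i ⊆ P.Ω) (hm : ∀ i, MeasurableSet (D i))
    (v : P.Vh) : ∑ i, P.a (D i) v v ≤ P.overlap D * P.a P.Ω v v := by
  classical
  simp only [a_eq]
  set f : Pt d → ℝ := fun x =>
    P.coeffForm x (gradient (v : Pt d → ℝ) x) (gradient (v : Pt d → ℝ) x) with hf
  have h1 : ∀ i, ∫ x in D i, f x = ∫ x in P.Ω, (D i).indicator f x := by
    intro i
    rw [setIntegral_indicator (hm i), Set.inter_eq_right.2 (hD i)]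
  simp only [h1]
  have hint : IntegrableOn f P.Ω := integrable_energy v v
  rw [← integral_finsetSum _ fun i _ => hint.indicator (hm i), ← integral_const_mul]
  refine setIntegral_mono_on (integrable_finsetSum _ fun i _ => hint.indicator (hm i))
    (hint.const_mul _) P.isOpen_Ω.measurableSet fun x hx => ?_
  simp only [Set.indicator_apply]
  rw [← Finset.sum_filter, Finset.sum_const, nsmul_eq_mul]
  exact mul_le_mul_of_nonneg_right (Nat.cast_le.2 (card_filter_le_overlap D hx))
    (coeffForm_self_nonneg hx _)

/-- At almost every point at most `ξ` of the gradients are nonzero, so the Cauchy–Schwarz estimate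
is applied pointwise to these alone. -/
theorem a_sum_le (e : Fin P.M → P.Vh) (he : ∀ i, e i ∈ P.Vh0 (P.ω i)) :
    P.a P.Ω (∑ i, e i : P.Vh) (∑ i, e i : P.Vh) ≤ P.overlap P.ω * ∑ i, P.a P.Ω (e i) (e i) := by
  classical
  simp only [a_eq]
  rw [← integral_finsetSum _ fun i _ => integrable_energy (e i) (e i), ← integral_const_mul]
  refine integral_mono_ae (integrable_energy _ _)
    ((integrable_finsetSum _ fun i _ => integrable_energy (e i) (e i)).const_mul _) ?_
  have hz : ∀ᵐ x, ∀ i, x ∉ P.ω i → gradient (e i : Pt d → ℝ) x = 0 :=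
    ae_all_iff.2 fun i => ae_gradient_eq_zero (P.resolves_ω i) (he i)
  filter_upwards [ae_restrict_of_ae hz, P.ae_differentiableAt,
    ae_restrict_mem P.isOpen_Ω.measurableSet] with x hzx hdx hx
  have hsum : gradient ((∑ i, e i : P.Vh) : Pt d → ℝ) x =
      ∑ i ∈ Finset.univ.filter fun i => x ∈ P.ω i, gradient (e i : Pt d → ℝ) x := by
    rw [AddSubmonoidClass.coe_finsetSum, gradient, fderiv_sum fun i _ => hdx (e i), map_sum,
      Finset.sum_filter]
    refine Finset.sum_congr rfl fun i _ => ?_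
    split_ifs with h
    · rfl
    · exact hzx i h
  rw [hsum]
  refine (bilinForm_sum_le _ (coeffForm_symm hx) (coeffForm_self_nonneg hx) _ _).trans ?_
  refine mul_le_mul (Nat.cast_le.2 (card_filter_le_overlap P.ω hx)) ?_
    (Finset.sum_nonneg fun i _ => coeffForm_self_nonneg hx _) (Nat.cast_nonneg _)
  exact Finset.sum_le_sum_of_subset_of_nonneg (Finset.filter_subset _ _)
    fun i _ _ => coeffForm_self_nonneg hx _

end Setting

/-! ### Truncation of eigenfunction expansions -/

theorem bilinForm_sum_smul {X ι : Type*} [AddCommGroup X] [Module ℝ X]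
    (B : LinearMap.BilinForm ℝ X) (I K : Finset ι) (c : ι → ℝ) (φ : ι → X) :
    B (∑ j ∈ I, c j • φ j) (∑ k ∈ K, c k • φ k) =
      ∑ j ∈ I, ∑ k ∈ K, c j * c k * B (φ j) (φ k) := by
  rw [map_sum B, LinearMap.sum_apply]
  refine Finset.sum_congr rfl fun j _ => ?_
  rw [map_sum]
  refine Finset.sum_congr rfl fun k _ => ?_
  simp only [map_smul, LinearMap.smul_apply, smul_eq_mul]
  ring

/-- Dropping the eigenfunctions with eigenvalues larger than the eigenvalue number `m + 1` leaves a
remainder that is controlled by this eigenvalue. -/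
theorem exists_truncation {X : Type*} [AddCommGroup X] [Module ℝ X] {a b : LinearMap.BilinForm ℝ X}
    (ha : ∀ x y, a x y = a y x) (ha0 : ∀ x, 0 ≤ a x x) (hb : ∀ x y, b x y = b y x)
    {N : ℕ} {φ : Fin N → X} {lam : Fin N → ℝ≥0∞} (hlam : Antitone lam)
    (htop : ∀ j k, lam j = ∞ → a (φ j) (φ k) = 0)
    (hfin : ∀ j k, lam j ≠ ∞ → b (φ j) (φ k) = (lam j).toReal * a (φ j) (φ k))
    {m : ℕ} (hm : Setting.nextEigenvalue lam m ≠ ∞) (hmN : m ≤ N) (c : Fin N → ℝ) :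
    ∃ J : Finset (Fin N), (∀ j ∉ J, (j : ℕ) < m) ∧
      b (∑ j ∈ J, c j • φ j) (∑ j ∈ J, c j • φ j) ≤
        (Setting.nextEigenvalue lam m).toReal * a (∑ j, c j • φ j) (∑ j, c j • φ j) := by
  classical
  by_cases h : m < N
  swap
  -- All eigenfunctions are used; nothing remains, in accordance with the default eigenvalue zero.
  · refine ⟨∅, fun j _ => by omega, ?_⟩
    simp [Setting.nextEigenvalue, h]
  set μ := Setting.nextEigenvalue lam m with hμ
  have hμm : μ = lam ⟨m, h⟩ := dif_pos h
  have horth : ∀ j k, lam j ≠ lam k → a (φ j) (φ k) = 0 := by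
    intro j k hjk
    by_cases hj : lam j = ∞
    · exact htop j k hj
    by_cases hk : lam k = ∞
    · rw [ha]; exact htop k j hk
    have h1 := hfin j k hj
    rw [hb, hfin k j hk, ha] at h1
    have h2 : (lam k).toReal ≠ (lam j).toReal := fun h =>
      hjk ((ENNReal.toReal_eq_toReal_iff' hk hj).1 h).symm
    exact (mul_eq_mul_right_iff.1 h1).resolve_left h2
  -- Selection by eigenvalue instead of index keeps eigenspaces whole. The basis need not be
  -- orthogonal within an eigenspace, and index `m` may split one.
  set J : Finset (Fin N) := Finset.univ.filter fun j => lam j ≤ μ with hJ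
  have hJtop : ∀ j ∈ J, lam j ≠ ∞ := fun j hj =>
    ((Finset.mem_filter.1 hj).2.trans_lt (lt_top_iff_ne_top.2 hm)).ne
  refine ⟨J, fun j hj => ?_, ?_⟩
  · by_contra! hmj
    exact hj (Finset.mem_filter.2 ⟨Finset.mem_univ _, hμm ▸ hlam (show (⟨m, h⟩ : Fin N) ≤ j from hmj)⟩)
  -- Components of distinct eigenvalues are orthogonal for both forms, and on one component `b` is
  -- the eigenvalue times `a`.
  let g : ℝ≥0∞ → X := fun t => ∑ j ∈ J with lam j = t, c j • φ j
  have hg : ∑ j ∈ J, c j • φ j = ∑ t ∈ J.image lam, g t :=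
    (Finset.sum_fiberwise_of_maps_to (fun j hj => Finset.mem_image_of_mem lam hj) _).symm
  have hgorth : ∀ t t', t ≠ t' → a (g t) (g t') = 0 := by
    intro t t' htt
    rw [bilinForm_sum_smul]
    refine Finset.sum_eq_zero fun j hj => Finset.sum_eq_zero fun k hk => ?_
    rw [horth, mul_zero]
    rwa [(Finset.mem_filter.1 hj).2, (Finset.mem_filter.1 hk).2]
  have hgb : ∀ t t', b (g t) (g t') = t.toReal * a (g t) (g t') := by
    intro t t'
    rw [bilinForm_sum_smul, bilinForm_sum_smul]
    simp only [Finset.mul_sum]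
    refine Finset.sum_congr rfl fun j hj => Finset.sum_congr rfl fun k hk => ?_
    rw [hfin j k (hJtop j (Finset.mem_filter.1 hj).1), (Finset.mem_filter.1 hj).2]
    ring
  have hs : ∀ B : LinearMap.BilinForm ℝ X, (∀ t t', t ≠ t' → B (g t) (g t') = 0) →
      B (∑ j ∈ J, c j • φ j) (∑ j ∈ J, c j • φ j) = ∑ t ∈ J.image lam, B (g t) (g t) := by
    intro B hB
    rw [hg]
    simp only [map_sum, LinearMap.sum_apply]
    refine Finset.sum_congr rfl fun t ht => ?_
    refine Finset.sum_eq_single_of_mem t ht fun t' _ htt => ?_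
    exact hB _ _ htt
  have h1 : b (∑ j ∈ J, c j • φ j) (∑ j ∈ J, c j • φ j) ≤
      μ.toReal * a (∑ j ∈ J, c j • φ j) (∑ j ∈ J, c j • φ j) := by
    rw [hs a hgorth, hs b fun t t' htt => by rw [hgb, hgorth t t' htt, mul_zero], Finset.mul_sum]
    refine Finset.sum_le_sum fun t ht => ?_
    rw [hgb]
    refine mul_le_mul_of_nonneg_right ?_ (ha0 _)
    obtain ⟨j, hj, rfl⟩ := Finset.mem_image.1 ht
    exact ENNReal.toReal_mono hm (Finset.mem_filter.1 hj).2
  refine h1.trans (mul_le_mul_of_nonneg_left ?_ ENNReal.toReal_nonneg)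
  rw [← Finset.sum_add_sum_compl J]
  -- No eigenvalue occurs both in `J` and in its complement, so adding the complementary part can
  -- only increase the energy.
  have hcross : a (∑ j ∈ J, c j • φ j) (∑ j ∈ Jᶜ, c j • φ j) = 0 := by
    rw [bilinForm_sum_smul]
    refine Finset.sum_eq_zero fun j hj => Finset.sum_eq_zero fun k hk => ?_
    rw [horth, mul_zero]
    intro hjk
    simp only [hJ, Finset.mem_compl, Finset.mem_filter, Finset.mem_univ, true_and] at hj hk
    first | exact hj (hjk ▸ hk) | exact hk (hjk ▸ hj)
  have h2 := ha0 (∑ j ∈ Jᶜ, c j • φ j)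
  have h3 : a (∑ j ∈ Jᶜ, c j • φ j) (∑ j ∈ J, c j • φ j) = 0 := by rw [ha, hcross]
  simp only [map_add, LinearMap.add_apply, hcross, h3]
  linarith

/-! ### Galerkin projections -/

section Galerkin

variable {V : Type*} [AddCommGroup V] [Module ℝ V] {n r : ℕ} (B : LinearMap.BilinForm ℝ V)
  (ψ : Basis (Fin n) ℝ V) {W : Submodule ℝ V} (b : Basis (Fin r) ℝ W)

/-- The projection onto `W` that is orthogonal with respect to `B`, in matrix form. -/
def galerkin : V →ₗ[ℝ] W :=
  Matrix.toLin ψ b (((LinearMap.toMatrix b ψ W.subtype)ᵀ * LinearMap.BilinForm.toMatrix ψ B *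
    LinearMap.toMatrix b ψ W.subtype)⁻¹ * (LinearMap.toMatrix b ψ W.subtype)ᵀ *
      LinearMap.BilinForm.toMatrix ψ B)

theorem dotProduct_toMatrix (u v : V) :
    (ψ.repr u : Fin n → ℝ) ⬝ᵥ LinearMap.BilinForm.toMatrix ψ B *ᵥ (ψ.repr v : Fin n → ℝ) = B u v := by
  have h := LinearMap.BilinForm.dotProduct_toMatrix_mulVec ψ B (ψ.equivFun u) (ψ.equivFun v)
  simpa using h

variable {B}

/-- A kernel vector, paired with itself, represents some `w` with `B w w = 0`. -/
theorem isUnit_det_galerkin (hB : ∀ v, B v v = 0 → v = 0) :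
    IsUnit ((LinearMap.toMatrix b ψ W.subtype)ᵀ * LinearMap.BilinForm.toMatrix ψ B *
      LinearMap.toMatrix b ψ W.subtype).det := by
  rw [isUnit_iff_ne_zero]
  intro hdet
  obtain ⟨y, hy0, hy⟩ := Matrix.exists_mulVec_eq_zero_iff.2 hdet
  obtain ⟨w, rfl⟩ : ∃ w : W, (b.repr w : Fin r → ℝ) = y :=
    ⟨b.equivFun.symm y, b.equivFun.apply_symm_apply y⟩
  refine hy0 ?_
  have h1 := congrArg (fun z => (b.repr w : Fin r → ℝ) ⬝ᵥ z) hy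
  simp only [Matrix.mul_assoc, ← Matrix.mulVec_mulVec, LinearMap.toMatrix_mulVec_repr,
    dotProduct_zero] at h1
  rw [Matrix.dotProduct_mulVec, Matrix.vecMul_transpose, LinearMap.toMatrix_mulVec_repr,
    dotProduct_toMatrix] at h1
  have h2 : w = 0 := Subtype.ext (hB _ h1)
  rw [h2]
  simp

theorem apply_galerkin (hB : ∀ v, B v v = 0 → v = 0) {w : V} (hw : w ∈ W) (v : V) :
    B w (galerkin B ψ b v) = B w v := by
  set E := LinearMap.toMatrix b ψ W.subtype with hE
  set M := LinearMap.BilinForm.toMatrix ψ B with hM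
  have h1 : (b.repr (galerkin B ψ b v) : Fin r → ℝ) =
      ((Eᵀ * M * E)⁻¹ * Eᵀ * M) *ᵥ (ψ.repr v : Fin n → ℝ) := by
    rw [← LinearMap.toMatrix_mulVec_repr ψ b, galerkin, LinearMap.toMatrix_toLin]
  have h2 : (Eᵀ * M * E) *ᵥ (b.repr (galerkin B ψ b v) : Fin r → ℝ) =
      (Eᵀ * M) *ᵥ (ψ.repr v : Fin n → ℝ) := by
    rw [h1, Matrix.mulVec_mulVec, Matrix.mul_assoc (Eᵀ * M * E)⁻¹, ← Matrix.mul_assoc,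
      Matrix.mul_nonsing_inv _ (isUnit_det_galerkin ψ b hB), Matrix.one_mul]
  have h3 := congrArg (fun z => (b.repr ⟨w, hw⟩ : Fin r → ℝ) ⬝ᵥ z) h2
  simp only [Matrix.mul_assoc, ← Matrix.mulVec_mulVec] at h3
  rw [hE, LinearMap.toMatrix_mulVec_repr, ← hE, Matrix.dotProduct_mulVec,
    Matrix.vecMul_transpose, Matrix.dotProduct_mulVec _ Eᵀ, Matrix.vecMul_transpose, hE,
    LinearMap.toMatrix_mulVec_repr, hM, dotProduct_toMatrix, dotProduct_toMatrix] at h3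
  exact h3

theorem toMatrix_galerkin (f : W →ₗ[ℝ] W) :
    LinearMap.toMatrix ψ ψ (W.subtype ∘ₗ f ∘ₗ galerkin B ψ b) =
      LinearMap.toMatrix b ψ W.subtype * LinearMap.toMatrix b b f *
        ((LinearMap.toMatrix b ψ W.subtype)ᵀ * LinearMap.BilinForm.toMatrix ψ B *
          LinearMap.toMatrix b ψ W.subtype)⁻¹ * (LinearMap.toMatrix b ψ W.subtype)ᵀ *
            LinearMap.BilinForm.toMatrix ψ B := by
  rw [LinearMap.toMatrix_comp ψ b ψ, LinearMap.toMatrix_comp ψ b b, galerkin,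
    LinearMap.toMatrix_toLin]
  simp only [Matrix.mul_assoc]

end Galerkin

/-! ### Vector and matrix norms -/

theorem matNorm_le {n : ℕ} {A W : Matrix (Fin n) (Fin n) ℝ} {C : ℝ≥0∞}
    (h : ∀ v, ENNReal.ofReal (vecNorm A (W *ᵥ v)) ≤ C * ENNReal.ofReal (vecNorm A v)) :
    matNorm A W ≤ C :=
  iSup_le fun v => ENNReal.div_le_of_le_mul (h v.1)

section Norms

variable {V : Type*} [AddCommGroup V] [Module ℝ V] {n : ℕ} {B : LinearMap.BilinForm ℝ V}

/-- The norm induced by a symmetric positive definite form is subadditive. -/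
theorem sqrt_form_add_le (hB : ∀ u v, B u v = B v u) (hB0 : ∀ v, 0 ≤ B v v) (u v : V) :
    √(B (u + v) (u + v)) ≤ √(B u u) + √(B v v) := by
  have hcs : B u v ≤ √(B u u) * √(B v v) := by
    rw [← Real.sqrt_mul (hB0 u)]
    refine Real.le_sqrt_of_sq_le ?_
    have h1 := hB0 (B v v • u - B u v • v)
    have h2 : ∀ t : ℝ, 0 ≤ B u u + 2 * t * B u v + t ^ 2 * B v v := by
      intro t
      have := hB0 (u + t • v)
      simp only [map_add, LinearMap.add_apply, map_smul, LinearMap.smul_apply, smul_eq_mul,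
        hB v u] at this
      linarith
    have h3 := discrim_le_zero (a := B v v) (b := 2 * B u v) (c := B u u)
      fun t => by linarith [h2 t]
    rw [discrim] at h3
    linarith
  rw [Real.sqrt_le_left (by positivity), add_sq, Real.sq_sqrt (hB0 u), Real.sq_sqrt (hB0 v)]
  simp only [map_add, LinearMap.add_apply, hB v u]
  linarith

variable (ψ : Basis (Fin n) ℝ V)

theorem vecNorm_repr (v : V) :
    vecNorm (LinearMap.BilinForm.toMatrix ψ B) (ψ.repr v) = √(B v v) := by
  rw [vecNorm, dotProduct_toMatrix]

theorem exists_repr_eq (x : Fin n → ℝ) : ∃ v : V, (ψ.repr v : Fin n → ℝ) = x :=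
  ⟨ψ.equivFun.symm x, ψ.equivFun.apply_symm_apply x⟩

theorem vecNorm_add_le (hB : ∀ u v, B u v = B v u) (hB0 : ∀ v, 0 ≤ B v v) (x y : Fin n → ℝ) :
    vecNorm (LinearMap.BilinForm.toMatrix ψ B) (x + y) ≤
      vecNorm (LinearMap.BilinForm.toMatrix ψ B) x +
        vecNorm (LinearMap.BilinForm.toMatrix ψ B) y := by
  obtain ⟨u, rfl⟩ := exists_repr_eq ψ x
  obtain ⟨v, rfl⟩ := exists_repr_eq ψ y
  rw [← Finsupp.coe_add, ← map_add, vecNorm_repr, vecNorm_repr, vecNorm_repr]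
  exact sqrt_form_add_le hB hB0 u v

theorem eq_zero_of_vecNorm_eq_zero (hB0 : ∀ v, 0 ≤ B v v) (hBd : ∀ v, B v v = 0 → v = 0)
    {x : Fin n → ℝ} (hx : vecNorm (LinearMap.BilinForm.toMatrix ψ B) x = 0) : x = 0 := by
  obtain ⟨v, rfl⟩ := exists_repr_eq ψ x
  rw [vecNorm_repr, Real.sqrt_eq_zero (hB0 v)] at hx
  simp [hBd v hx]

/-- A matrix that differs from the identity by a contraction is invertible, with the usual bound of
the condition number. -/
theorem condition_le (hB : ∀ u v, B u v = B v u) (hB0 : ∀ v, 0 ≤ B v v)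
    (hBd : ∀ v, B v v = 0 → v = 0) {W : Matrix (Fin n) (Fin n) ℝ} {C : ℝ} (hC0 : 0 ≤ C)
    (hC1 : C < 1)
    (h : ∀ x, vecNorm (LinearMap.BilinForm.toMatrix ψ B) ((1 - W) *ᵥ x) ≤
      C * vecNorm (LinearMap.BilinForm.toMatrix ψ B) x) :
    IsUnit W ∧ matNorm (LinearMap.BilinForm.toMatrix ψ B) W *
      matNorm (LinearMap.BilinForm.toMatrix ψ B) W⁻¹ ≤
        (1 + ENNReal.ofReal C) / (1 - ENNReal.ofReal C) := by
  set A := LinearMap.BilinForm.toMatrix ψ B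
  have hnn : ∀ x, 0 ≤ vecNorm A x := fun x => Real.sqrt_nonneg _
  have hneg : ∀ x, vecNorm A (-x) = vecNorm A x := by
    intro x
    simp [vecNorm, Matrix.mulVec_neg]
  have hlow : ∀ x, (1 - C) * vecNorm A x ≤ vecNorm A (W *ᵥ x) := by
    intro x
    have h1 := vecNorm_add_le ψ hB hB0 (W *ᵥ x) ((1 - W) *ᵥ x)
    rw [← Matrix.add_mulVec, add_sub_cancel, Matrix.one_mulVec] at h1
    linarith [h x]
  have hup : ∀ x, vecNorm A (W *ᵥ x) ≤ (1 + C) * vecNorm A x := by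
    intro x
    have h1 := vecNorm_add_le ψ hB hB0 x (-((1 - W) *ᵥ x))
    rw [hneg, ← sub_eq_add_neg, Matrix.sub_mulVec, Matrix.one_mulVec, sub_sub_cancel] at h1
    have h2 := h x
    rw [Matrix.sub_mulVec, Matrix.one_mulVec] at h2
    linarith
  have hunit : IsUnit W := by
    rw [Matrix.isUnit_iff_isUnit_det, isUnit_iff_ne_zero]
    intro hdet
    obtain ⟨x, hx0, hx⟩ := Matrix.exists_mulVec_eq_zero_iff.2 hdet
    refine hx0 (eq_zero_of_vecNorm_eq_zero ψ hB0 hBd (le_antisymm ?_ (hnn x)))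
    have h1 := hlow x
    rw [hx, show vecNorm A 0 = 0 by simp [vecNorm]] at h1
    by_contra! h2
    nlinarith
  refine ⟨hunit, ?_⟩
  have hC1' : 0 < 1 - C := sub_pos.2 hC1
  have hN1 : matNorm A W ≤ ENNReal.ofReal (1 + C) := matNorm_le fun x => by
    rw [← ENNReal.ofReal_mul (by linarith)]
    exact ENNReal.ofReal_le_ofReal (hup x)
  have hN2 : matNorm A W⁻¹ ≤ ENNReal.ofReal (1 - C)⁻¹ := matNorm_le fun x => by
    rw [← ENNReal.ofReal_mul (inv_nonneg.2 hC1'.le)]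
    refine ENNReal.ofReal_le_ofReal ?_
    have h1 := hlow (W⁻¹ *ᵥ x)
    rw [Matrix.mulVec_mulVec, Matrix.mul_nonsing_inv _ ((Matrix.isUnit_iff_isUnit_det W).1 hunit),
      Matrix.one_mulVec] at h1
    rwa [inv_mul_eq_div, le_div_iff₀' hC1']
  refine (mul_le_mul' hN1 hN2).trans (le_of_eq ?_)
  rw [ENNReal.ofReal_inv_of_pos hC1', ENNReal.ofReal_add zero_le_one hC0,
    ENNReal.ofReal_sub _ hC0, ENNReal.ofReal_one, div_eq_mul_inv]

end Norms

namespace Setting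

variable {d : ℕ} (P : Setting d)

/-! ### The local splittings -/

theorem a_toLoc (i : Fin P.M) (u v : P.Vh) :
    P.a (P.ωs i) (P.toLoc (P.ωs i) u : Pt d → ℝ) (P.toLoc (P.ωs i) v : Pt d → ℝ) =
      P.aForm (P.ωs_subset i) u v := by
  rw [toLoc_apply, toLoc_apply, a_indicator_left (P.resolves_ωs i).isOpen,
    a_indicator_right (P.resolves_ωs i).isOpen, aForm_apply]

/-- Lifts of local functions to `V_h` are not unique; this makes the choice immaterial. -/
theorem pouOp_congr {i : Fin P.M} {u v : P.Vh} (h : P.toLoc (P.ωs i) u = P.toLoc (P.ωs i) v) :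
    P.pouOp i u = P.pouOp i v := by
  have h1 : P.toLoc (P.ω i) u = P.toLoc (P.ω i) v := by
    rw [← locRestr_toLoc, ← locRestr_toLoc, h]
  change ((P.chi i (P.toLoc (P.ω i) u) : P.Vh)) = (P.chi i (P.toLoc (P.ω i) v) : P.Vh)
  rw [h1]

variable {P}

/-- The image of a discrete harmonic function under the partition of unity operator is approximated
by the images of the first `m` eigenfunctions. -/
theorem exists_local_splitting {i : Fin P.M} {N : ℕ} {φ : Fin N → P.VhLoc (P.ωs i)}
    {lam : Fin N → ℝ≥0∞} (hφ : P.IsEigensystem i φ lam) {m : ℕ} (hmN : m ≤ N)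
    (hm : nextEigenvalue lam m ≠ ∞) {z : P.Vh}
    (hz : P.toLoc (P.ωs i) z ∈ P.harmonic (P.ωs i)) :
    ∃ e s : P.Vh, P.pouOp i z = e + s ∧ e ∈ P.Vh0 (P.ω i) ∧
      s ∈ (P.localApprox i φ m).map ((P.Vh0 (P.ω i)).subtype ∘ₗ P.chi i) ∧
      P.a P.Ω e e ≤ (nextEigenvalue lam m).toReal * P.a (P.ωs i) z z := by
  -- Working with lifts puts both forms of the eigenproblem on `V_h`, where they are bilinear.
  have hlift : ∀ j, ∃ u : P.Vh, P.toLoc (P.ωs i) u = φ j := by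
    intro j
    obtain ⟨v, hv, h⟩ := (φ j).2
    exact ⟨⟨v, hv⟩, Subtype.ext h⟩
  choose u hu using hlift
  rw [← hφ.span_eq, SetLike.mem_coe, Submodule.mem_span_range_iff_exists_fun] at hz
  obtain ⟨c, hc⟩ := hz
  have hm1 := (P.resolves_ω i).isOpen.measurableSet
  have hm2 := (P.resolves_ωs i).isOpen.measurableSet
  have hharm : ∀ k, φ k ∈ P.harmonic (P.ωs i) := fun k => (hφ.isEigenpair k).1
  obtain ⟨J, hJ, hJle⟩ := exists_truncation
    (a := P.aForm (P.ωs_subset i))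
    (b := (P.aForm (P.ω_subset i)).compl₁₂ (P.pouOp i) (P.pouOp i))
    (aForm_symm _ hm2) (aForm_self_nonneg _ hm2)
    (fun x y => aForm_symm (P.ω_subset i) hm1 (P.pouOp i x) (P.pouOp i y))
    (φ := u) hφ.antitone
    (fun j k hj => by
      have := ((hφ.isEigenpair j).2.2 (φ k) (hharm k)).1 hj
      rwa [← hu, ← hu, a_toLoc] at this)
    (fun j k hj => by
      have := ((hφ.isEigenpair j).2.2 (φ k) (hharm k)).2 hj
      rwa [← hu, ← hu, a_toLoc, locRestr_toLoc, locRestr_toLoc] at this)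
    hm hmN c
  have hcz : P.toLoc (P.ωs i) (∑ j, c j • u j) = P.toLoc (P.ωs i) z := by
    rw [← hc, map_sum]
    simp only [map_smul, hu]
  refine ⟨P.pouOp i (∑ j ∈ J, c j • u j), P.pouOp i (∑ j ∈ Jᶜ, c j • u j), ?_, P.pouOp_mem i _,
    ?_, ?_⟩
  · rw [← map_add, Finset.sum_add_sum_compl, P.pouOp_congr hcz]
  · refine ⟨P.toLoc (P.ω i) (∑ j ∈ Jᶜ, c j • u j), ?_, rfl⟩
    rw [map_sum]
    refine Submodule.sum_mem _ fun j hj => ?_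
    rw [map_smul]
    refine Submodule.smul_mem _ _ (Submodule.subset_span ⟨j, hJ j (Finset.mem_compl.1 hj), ?_⟩)
    rw [← hu, locRestr_toLoc]
  · rw [a_eq_of_mem_Vh0 (P.resolves_ω i) _ (P.pouOp_mem i _)]
    refine hJle.trans (le_of_eq ?_)
    rw [← a_toLoc, hcz, a_toLoc, aForm_apply]

/-! ### The preconditioned operator -/

theorem stiffness_eq {n : ℕ} (ψ : Basis (Fin n) ℝ P.Vh) :
    P.stiffness ψ = LinearMap.BilinForm.toMatrix ψ (P.aForm subset_rfl) := by
  ext k l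
  rw [LinearMap.BilinForm.toMatrix_apply]
  rfl

section Precond

variable {n r : ℕ} (ψ : Basis (Fin n) ℝ P.Vh) {k : Fin P.M → ℕ}
  (b : ∀ i, Basis (Fin (k i)) ℝ (P.Vh0 (P.ωs i))) {S : Submodule ℝ P.Vh} (c : Basis (Fin r) ℝ S)

/-- The one-level operator on `V_h`. -/
def oneLevelOp : P.Vh →ₗ[ℝ] P.Vh :=
  ∑ i, (P.Vh0 (P.ωs i)).subtype ∘ₗ P.chiTilde i ∘ₗ galerkin (P.aForm subset_rfl) ψ (b i)

/-- The projection onto the coarse space, as an operator on `V_h`. -/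
def coarseOp : P.Vh →ₗ[ℝ] P.Vh := S.subtype ∘ₗ LinearMap.id ∘ₗ galerkin (P.aForm subset_rfl) ψ c

theorem toMatrix_oneLevelOp :
    LinearMap.toMatrix ψ ψ (oneLevelOp ψ b) = P.oneLevel ψ b * P.stiffness ψ := by
  rw [oneLevelOp, map_sum, oneLevel, Finset.sum_mul, stiffness_eq]
  refine Finset.sum_congr rfl fun i _ => ?_
  rw [toMatrix_galerkin]
  rfl

theorem toMatrix_coarseOp :
    LinearMap.toMatrix ψ ψ (coarseOp ψ c) = P.coarseLevel ψ c * P.stiffness ψ := by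
  rw [coarseOp, toMatrix_galerkin, LinearMap.toMatrix_id, Matrix.mul_one, coarseLevel,
    stiffness_eq]
  rfl

/-- The error propagation operator of the preconditioned Richardson iteration. -/
def errorOp : P.Vh →ₗ[ℝ] P.Vh :=
  (LinearMap.id - coarseOp ψ c) ∘ₗ (LinearMap.id - oneLevelOp ψ b)

theorem errorOp_apply (v : P.Vh) : errorOp ψ b c v =
    (v - oneLevelOp ψ b v) - coarseOp ψ c (v - oneLevelOp ψ b v) := rfl

/-- The hybrid form of `B` is chosen so that the error operator factors: the coarse correction acts
multiplicatively on the residual of the one-level step. -/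
theorem toMatrix_errorOp :
    LinearMap.toMatrix ψ ψ (errorOp ψ b c) = 1 - P.precond ψ b c * P.stiffness ψ := by
  rw [errorOp, LinearMap.toMatrix_comp ψ ψ ψ, map_sub (LinearMap.toMatrix ψ ψ),
    map_sub (LinearMap.toMatrix ψ ψ), LinearMap.toMatrix_id, toMatrix_oneLevelOp,
    toMatrix_coarseOp, precond]
  noncomm_ring

/-- The energy of the error of the coarse projection is minimal. -/
theorem coarse_error_le (hd : d ≠ 0) (e : P.Vh) {s : P.Vh} (hs : s ∈ S) :
    P.a P.Ω ((e + s) - coarseOp ψ c (e + s) : P.Vh) ((e + s) - coarseOp ψ c (e + s) : P.Vh) ≤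
      P.a P.Ω e e := by
  have hm := P.isOpen_Ω.measurableSet
  set B := P.aForm (subset_rfl : P.Ω ⊆ P.Ω) with hB
  set q := (e + s) - coarseOp ψ c (e + s) with hq
  set t := coarseOp ψ c (e + s) - s with ht
  have htS : t ∈ S := S.sub_mem (galerkin B ψ c (e + s)).2 hs
  have horth : B t q = 0 := by
    rw [hq, map_sub, sub_eq_zero]
    exact (apply_galerkin ψ c (fun v hv => eq_zero_of_a_self_eq_zero hd hv) htS _).symm
  -- Pythagoras: the error `q` is orthogonal to the coarse space, and `e` differs from it by the
  -- coarse function `t`.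
  have he : e = q + t := by rw [hq, ht]; abel
  change B q q ≤ B e e
  have h1 : B q t = 0 := by rw [aForm_symm _ hm]; exact horth
  have h2 : 0 ≤ B t t := aForm_self_nonneg _ hm t
  rw [he]
  simp only [map_add, LinearMap.add_apply, horth, h1]
  linarith

end Precond

/-- The squared form of the contraction estimate. Its constant collects `ξ` from the sum of the
local errors, `μ` from the truncations and `ξ^*` from the sum of the local energies. -/
theorem error_le (hd : d ≠ 0) {N : Fin P.M → ℕ} {φ : ∀ i, Fin (N i) → P.VhLoc (P.ωs i)}
    {lam : ∀ i, Fin (N i) → ℝ≥0∞} (hφ : ∀ i, P.IsEigensystem i (φ i) (lam i))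
    {m : Fin P.M → ℕ} (hm : ∀ i, m i ≤ N i) {n : ℕ} (ψ : Basis (Fin n) ℝ P.Vh)
    {k : Fin P.M → ℕ} (b : ∀ i, Basis (Fin (k i)) ℝ (P.Vh0 (P.ωs i)))
    {r : ℕ} (c : Basis (Fin r) ℝ (P.coarse φ m)) {μ : ℝ} (hμ0 : 0 ≤ μ)
    (hfin : ∀ i, nextEigenvalue (lam i) (m i) ≠ ∞)
    (hμ : ∀ i, (nextEigenvalue (lam i) (m i)).toReal ≤ μ) (v : P.Vh) :
    P.a P.Ω (errorOp ψ b c v) (errorOp ψ b c v) ≤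
      P.overlap P.ω * P.overlap P.ωs * μ * P.a P.Ω v v := by
  let p : ∀ i, P.Vh0 (P.ωs i) := fun i => galerkin (P.aForm subset_rfl) ψ (b i) v
  -- Test functions in `V_{h,0}(ω_i^*)` see only `ω_i^*`, so the global orthogonality of the
  -- projection is also local. It yields that the remainder is harmonic and that its local energy
  -- does not exceed that of `v`.
  have hp : ∀ i, ∀ u ∈ P.Vh0 (P.ωs i),
      P.aForm (P.ωs_subset i) (p i) u = P.aForm (P.ωs_subset i) v u := by
    intro i u hu
    have h1 := apply_galerkin (B := P.aForm subset_rfl) ψ (b i)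
      (fun v hv => eq_zero_of_a_self_eq_zero hd hv) hu v
    rw [aForm_symm _ P.isOpen_Ω.measurableSet, aForm_symm _ P.isOpen_Ω.measurableSet u] at h1
    rw [aForm_apply, aForm_apply, ← a_eq_of_mem_Vh0 (P.resolves_ωs i) _ hu,
      ← a_eq_of_mem_Vh0 (P.resolves_ωs i) _ hu]
    exact h1
  have hz : ∀ i, P.toLoc (P.ωs i) (v - p i) ∈ P.harmonic (P.ωs i) := by
    intro i u hu
    rw [toLoc_apply, a_indicator_left (P.resolves_ωs i).isOpen,
      ← aForm_apply (P.ωs_subset i), map_sub, LinearMap.sub_apply, hp i u hu, sub_self]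
  have hzle : ∀ i, P.a (P.ωs i) (v - p i : P.Vh) (v - p i : P.Vh) ≤ P.a (P.ωs i) v v := by
    intro i
    have hms := (P.resolves_ωs i).isOpen.measurableSet
    rw [← aForm_apply (P.ωs_subset i), ← aForm_apply (P.ωs_subset i)]
    have h1 := hp i _ (p i).2
    have h2 := aForm_self_nonneg (P.ωs_subset i) hms (p i : P.Vh)
    have h3 := aForm_symm (P.ωs_subset i) hms v (p i)
    simp only [map_sub, LinearMap.sub_apply]
    linarith
  choose e s hes he hs hle using fun i => exists_local_splitting (hφ i) (hm i) (hfin i) (hz i)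
  -- Writing `v` as the sum of its partition of unity images turns the one-level residual into a sum
  -- over the harmonic remainders.
  have hsplit : v - oneLevelOp ψ b v = ∑ i, e i + ∑ i, s i := by
    have h1 : oneLevelOp ψ b v = ∑ i, P.pouOp i (p i) := by
      rw [oneLevelOp, LinearMap.sum_apply]
      rfl
    rw [h1, ← Finset.sum_add_distrib]
    nth_rw 1 [← P.sum_pouOp v]
    rw [← Finset.sum_sub_distrib]
    refine Finset.sum_congr rfl fun i _ => ?_
    rw [← hes, map_sub]
  have hsS : ∑ i, s i ∈ P.coarse φ m :=
    Submodule.sum_mem _ fun i _ => Submodule.mem_iSup_of_mem i (hs i)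
  have hw : P.a P.Ω (errorOp ψ b c v) (errorOp ψ b c v) ≤
        P.a P.Ω (∑ i, e i : P.Vh) (∑ i, e i : P.Vh) := by
    have := coarse_error_le ψ c hd (∑ i, e i) hsS
    rwa [← hsplit, ← errorOp_apply] at this
  have hv0 : ∀ i, 0 ≤ P.a (P.ωs i) v v := fun i =>
    aForm_self_nonneg (P.ωs_subset i) (P.resolves_ωs i).isOpen.measurableSet v
  calc P.a P.Ω (errorOp ψ b c v) (errorOp ψ b c v)
    _ ≤ P.overlap P.ω * ∑ i, P.a P.Ω (e i) (e i) := hw.trans (a_sum_le e he)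
    _ ≤ P.overlap P.ω * ∑ i, μ * P.a (P.ωs i) v v := by
      refine mul_le_mul_of_nonneg_left (Finset.sum_le_sum fun i _ => ?_) (Nat.cast_nonneg _)
      refine (hle i).trans ((mul_le_mul_of_nonneg_left (hzle i) ENNReal.toReal_nonneg).trans ?_)
      exact mul_le_mul_of_nonneg_right (hμ i) (hv0 i)
    _ ≤ P.overlap P.ω * (μ * (P.overlap P.ωs * P.a P.Ω v v)) := by
      rw [← Finset.mul_sum]
      refine mul_le_mul_of_nonneg_left (mul_le_mul_of_nonneg_left ?_ hμ0) (Nat.cast_nonneg _)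
      exact sum_a_le P.ωs P.ωs_subset (fun i => (P.resolves_ωs i).isOpen.measurableSet) v
    _ = P.overlap P.ω * P.overlap P.ωs * μ * P.a P.Ω v v := by ring

/-- Since `0 * ∞ = 0` in `ℝ≥0∞`, this needs both overlap numbers to be nonzero, which holds because
`Ω` is nonempty and covered. -/
theorem iSup_nextEigenvalue_ne_top {N : Fin P.M → ℕ} {lam : ∀ i, Fin (N i) → ℝ≥0∞}
    {m : Fin P.M → ℕ} (h : P.Lambda lam m ≠ ∞) :
    ⨆ i, nextEigenvalue (lam i) (m i) ≠ ∞ := by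
  intro htop
  refine h ?_
  rw [Lambda, htop, ENNReal.mul_top, ENNReal.top_rpow_of_pos (by norm_num)]
  exact mul_ne_zero (Nat.cast_ne_zero.2 P.overlap_ω_ne_zero)
    (Nat.cast_ne_zero.2 P.overlap_ωs_ne_zero)

theorem toReal_Lambda {N : Fin P.M → ℕ} (lam : ∀ i, Fin (N i) → ℝ≥0∞) (m : Fin P.M → ℕ) :
    (P.Lambda lam m).toReal =
      √(P.overlap P.ω * P.overlap P.ωs * (⨆ i, nextEigenvalue (lam i) (m i)).toReal) := by
  rw [Lambda, ← ENNReal.toReal_rpow, Real.sqrt_eq_rpow]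
  simp

end Setting

end MSGFEM

end

/-! ### The contraction and condition number bounds -/

theorem lemma3p5 {d : ℕ} (hd : d = 2 ∨ d = 3) (P : MSGFEM.Setting d)
    (N : Fin P.M → ℕ) (φ : ∀ i, Fin (N i) → P.VhLoc (P.ωs i)) (lam : ∀ i, Fin (N i) → ℝ≥0∞)
    (hφ : ∀ i, P.IsEigensystem i (φ i) (lam i))
    (m : Fin P.M → ℕ) (hm : ∀ i, m i ≤ N i)
    (n : ℕ) (ψ : Basis (Fin n) ℝ P.Vh)
    (k : Fin P.M → ℕ) (b : ∀ i, Basis (Fin (k i)) ℝ (P.Vh0 (P.ωs i)))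
    (r : ℕ) (c : Basis (Fin r) ℝ (P.coarse φ m))
    (A B : Matrix (Fin n) (Fin n) ℝ) (hA : A = P.stiffness ψ) (hB : B = P.precond ψ b c)
    (Λ : ℝ≥0∞) (hΛ : Λ = P.Lambda lam m) :
    MSGFEM.matNorm A (1 - B * A) ≤ Λ ∧
      (Λ < 1 → IsUnit (B * A) ∧
        MSGFEM.matNorm A (B * A) * MSGFEM.matNorm A (B * A)⁻¹ ≤ (1 + Λ) / (1 - Λ)) := by
  have hd0 : d ≠ 0 := by omega
  -- For infinite `Λ` the first bound is void and the second has a false premise; otherwise every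
  -- discarded eigenvalue is finite.
  by_cases hΛtop : Λ = ∞
  · subst hΛtop
    exact ⟨le_top, fun h => (not_top_lt h).elim⟩
  have hsup := MSGFEM.Setting.iSup_nextEigenvalue_ne_top (hΛ ▸ hΛtop : P.Lambda lam m ≠ ∞)
  have hle := fun i => le_iSup (fun i => MSGFEM.Setting.nextEigenvalue (lam i) (m i)) i
  have hbound : ∀ x, MSGFEM.vecNorm A ((1 - B * A) *ᵥ x) ≤ Λ.toReal * MSGFEM.vecNorm A x := by
    intro x
    obtain ⟨v, rfl⟩ := MSGFEM.exists_repr_eq ψ x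
    rw [hB, hA, ← MSGFEM.Setting.toMatrix_errorOp, LinearMap.toMatrix_mulVec_repr,
      MSGFEM.Setting.stiffness_eq, MSGFEM.vecNorm_repr, MSGFEM.vecNorm_repr, hΛ,
      MSGFEM.Setting.toReal_Lambda, ← Real.sqrt_mul (by positivity)]
    exact Real.sqrt_le_sqrt (MSGFEM.Setting.error_le hd0 hφ hm ψ b c ENNReal.toReal_nonneg
      (fun i => ne_top_of_le_ne_top hsup (hle i))
      (fun i => ENNReal.toReal_mono hsup (hle i)) v)
  refine ⟨MSGFEM.matNorm_le fun x => ?_, fun hΛ1 => ?_⟩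
  · rw [← ENNReal.ofReal_toReal hΛtop, ← ENNReal.ofReal_mul ENNReal.toReal_nonneg]
    exact ENNReal.ofReal_le_ofReal (hbound x)
  · have hm := P.isOpen_Ω.measurableSet
    rw [hA, MSGFEM.Setting.stiffness_eq] at hbound ⊢
    rw [← ENNReal.ofReal_toReal hΛtop]
    exact MSGFEM.condition_le ψ (MSGFEM.Setting.aForm_symm _ hm)
      (MSGFEM.Setting.aForm_self_nonneg _ hm)
      (fun v hv => MSGFEM.Setting.eq_zero_of_a_self_eq_zero hd0 hv) ENNReal.toReal_nonneg
      (by simpa using (ENNReal.toReal_lt_toReal hΛtop ENNReal.one_ne_top).2 hΛ1) hbound
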